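/- Let $A$ be a pro-$C^*$-algebra, i.e. a complete Hausdorff topological $*$-algebra over $\mathbb C$ (not necessarily unital) whose topology is defined by an upward directed family $\{p_\lambda\}_{\lambda\in\Lambda}$ of $C^*$-seminorms. Put $A_\lambda=A/\ker p_\lambda$, with canonical map $\pi_\lambda^A:A\to A_\lambda$. A pro-$C^*$-isomorphism is a $*$-isomorphism that is a homeomorphism. Let $X$ be a Hilbert $A$-$A$ pro-$C^*$-bimodule: $X$ is a right Hilbert $A$-module with inner product $\langle\cdot,\cdot\rangle_A$ and a left Hilbert $A$-module with inner product ${}_A\langle\cdot,\cdot\rangle$ (both positive definite, and $X$ is complete for each of the two families of seminorms $p_\lambda^A(x)=p_\lambda(\langle x,x\rangle_A)^{1/2}$ and ${}^Ap_\lambda(x)=p_\lambda({}_A\langle x,x\rangle)^{1/2}$), such that ${}_A\langle x,y\rangle z=x\langle y,z\rangle_A$, $p_\lambda^A(ax)\le p_\lambda(a)\,p_\lambda^A(x)$ and ${}^Ap_\lambda(xa)\le p_\lambda(a)\,{}^Ap_\lambda(x)$ for all $x,y,z\in X$, $a\in A$, $\lambda\in\Lambda$. Let $L_A(X)$ be the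 $*$-algebra of adjointable right module morphisms of $X$, topologized by the seminorms $p_{\lambda,L_A(X)}(T)=\sup\{p_\lambda^A(Tx):p_\lambda^A(x)\le 1\}$, and let $K_A(X)$ be the closure in $L_A(X)$ of the linear span of the operators $\theta_{y,x}(z)=y\langle x,z\rangle_A$. Let $X_\lambda=X/\ker p_\lambda^A$, with its canonical structure of a Hilbert $A_\lambda$-module, let $\pi_\lambda:L_A(X)\to L_{A_\lambda}(X_\lambda)$ be the canonical map, and let $K_{A_\lambda}(X_\lambda)$ be the closure in $L_{A_\lambda}(X_\lambda)$ of the linear span of the analogous operators on $X_\lambda$. View $X$ as a pro-$C^*$-correspondence through $\varphi_X:A\to L_A(X)$, $\varphi_X(a)x=ax$, and set $$\mathcal J_X=\bigcap_{\lambda\in\Lambda}\{a\in A:\ \pi_\lambda(\varphi_X(a))\in K_{A_\lambda}(X_\lambda)\ \text{and}\ \pi^A_\lambda(ab)=0\ \text{for all } b\in\ker(\pi_\lambda\circ\varphi_X)\}.$$ Let ${}_AI$ be the closed ideal $\overline{\operatorname{span}}\{{}_A\langle x,y\rangle: x,y\in X\}$ of $A$. Then: 1. ${}_AI$ and $K_A(X)$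 are isomorphic as pro-$C^*$-algebras. 2. $\mathcal J_X={}_AI$. 3. There is a pro-$C^*$-isomorphism $\Psi:\mathcal J_X\to K_A(X)$ with $\Psi(a)x=ax$ for all $a\in\mathcal J_X$ and $x\in X$. -/

import Mathlib

open scoped ENNReal

noncomputable section

namespace ProCStar

universe u

section Algebra

set_option linter.unusedSectionVars false

variable {Λ : Type*} {A : Type u} [NonUnitalRing A] [StarRing A] [Module ℂ A]
  [IsScalarTower ℂ A A] [SMulCommClass ℂ A A] [StarModule ℂ A]

/-- Every member of the family `p` is a `C⋆`-seminorm on the `⋆`-algebra `A`. -/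
class CStarFamily (p : Λ → Seminorm ℂ A) : Prop where
  mul_le : ∀ l a b, p l (a * b) ≤ p l a * p l b
  star_mul_self : ∀ l a, p l (star a * a) = p l a ^ 2

/-- `A`, with its given topology, is a pro-`C⋆`-algebra whose topology is defined by the upward
directed family `p` of `C⋆`-seminorms: it is complete and Hausdorff. -/
class ProCStarAlgebra [UniformSpace A] [IsUniformAddGroup A] (p : Λ → Seminorm ℂ A) : Prop
    extends CStarFamily p where
  directed : Directed (· ≤ ·) p
  withSeminorms : WithSeminorms p
  complete : CompleteSpace A
  hausdorff : T2Space A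

theorem seminorm_star (p : Λ → Seminorm ℂ A) [CStarFamily p] (l : Λ) (a : A) :
    p l (star a) = p l a := by
  have key : ∀ b : A, p l b ≤ p l (star b) := by
    intro b
    have h1 := CStarFamily.star_mul_self (p := p) l b
    have h2 := CStarFamily.mul_le (p := p) l (star b) b
    rcases (apply_nonneg (p l) b).eq_or_lt with h | h
    · rw [← h]; exact apply_nonneg _ _
    · nlinarith
  refine le_antisymm ?_ (key a)
  simpa using key (star a)

/-- The kernel `N_l = {a | p_l(a) = 0}` of the seminorm `p l`. -/
def nullIdeal (p : Λ → Seminorm ℂ A) (l : Λ) : Submodule ℂ A where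
  carrier := {a | p l a = 0}
  zero_mem' := map_zero (p l)
  add_mem' {a b} ha hb := by
    have h := map_add_le_add (p l) a b
    rw [Set.mem_ofPred_eq] at *
    rw [ha, hb, add_zero] at h
    exact le_antisymm h (apply_nonneg _ _)
  smul_mem' c a ha := by
    rw [Set.mem_ofPred_eq] at *
    rw [map_smul_eq_mul, ha, mul_zero]

/-- A map that is semilinear in the first and linear in the second variable descends to
quotients if it vanishes on the submodules that are divided out. -/
def lift₂ {M M' P : Type*} [AddCommGroup M] [AddCommGroup M'] [AddCommGroup P] [Module ℂ M]
    [Module ℂ M'] [Module ℂ P] {σ : ℂ →+* ℂ} (N : Submodule ℂ M) (N' : Submodule ℂ M')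
    (f : M →ₛₗ[σ] M' →ₗ[ℂ] P) (h : ∀ m ∈ N, ∀ m', f m m' = 0) (h' : ∀ m, ∀ m' ∈ N', f m m' = 0) :
    M ⧸ N →ₛₗ[σ] M' ⧸ N' →ₗ[ℂ] P :=
  N.liftQ
    { toFun := fun m => N'.liftQ (f m) fun m' hm' => h' m m' hm'
      map_add' := fun a b => by
        apply Submodule.linearMap_qext
        ext m'
        change f (a + b) m' = f a m' + f b m'
        simp
      map_smul' := fun c a => by
        apply Submodule.linearMap_qext
        ext m'
        change f (c • a) m' = σ c • f a m'
        simp }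
    fun m hm => by
      rw [LinearMap.mem_ker]
      apply Submodule.linearMap_qext
      ext m'
      exact h m hm m'

/-- The quotient `A_l = A / N_l`. -/
def Level (p : Λ → Seminorm ℂ A) (l : Λ) : Type _ := A ⧸ nullIdeal p l

namespace Level

variable (p : Λ → Seminorm ℂ A) (l : Λ)

instance : AddCommGroup (Level p l) := inferInstanceAs (AddCommGroup (A ⧸ nullIdeal p l))

instance : Module ℂ (Level p l) := inferInstanceAs (Module ℂ (A ⧸ nullIdeal p l))

/-- The canonical map `π_l : A → A_l`. -/
def mk : A →ₗ[ℂ] Level p l := (nullIdeal p l).mkQ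

theorem mk_surjective : Function.Surjective (mk p l) := (nullIdeal p l).mkQ_surjective

variable {p l} in
theorem mk_eq_zero {a : A} : mk p l a = 0 ↔ p l a = 0 :=
  Submodule.Quotient.mk_eq_zero (nullIdeal p l)

variable [CStarFamily p]

instance : Mul (Level p l) where
  mul a b := lift₂ (nullIdeal p l) (nullIdeal p l) ((LinearMap.mul ℂ A).compr₂ (mk p l))
    (fun a ha b => mk_eq_zero.2 <| le_antisymm
      ((CStarFamily.mul_le l a b).trans_eq (by rw [show p l a = 0 from ha, zero_mul]))
      (apply_nonneg _ _))
    (fun a b hb => mk_eq_zero.2 <| le_antisymm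
      ((CStarFamily.mul_le l a b).trans_eq (by rw [show p l b = 0 from hb, mul_zero]))
      (apply_nonneg _ _)) a b

theorem mk_mul (a b : A) : mk p l (a * b) = mk p l a * mk p l b := rfl

instance : NonUnitalRing (Level p l) where
  left_distrib a b c := map_add (lift₂ (nullIdeal p l) (nullIdeal p l) _ _ _ a) b c
  right_distrib a b c := LinearMap.map_add₂ (lift₂ (nullIdeal p l) (nullIdeal p l) _ _ _) a b c
  zero_mul a := LinearMap.map_zero₂ (lift₂ (nullIdeal p l) (nullIdeal p l) _ _ _) a
  mul_zero a := map_zero (lift₂ (nullIdeal p l) (nullIdeal p l) _ _ _ a)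
  mul_assoc a b c := by
    obtain ⟨a, rfl⟩ := mk_surjective p l a
    obtain ⟨b, rfl⟩ := mk_surjective p l b
    obtain ⟨c, rfl⟩ := mk_surjective p l c
    simp only [← mk_mul, mul_assoc]

instance : IsScalarTower ℂ (Level p l) (Level p l) where
  smul_assoc c a b := by
    obtain ⟨a, rfl⟩ := mk_surjective p l a
    obtain ⟨b, rfl⟩ := mk_surjective p l b
    simp only [smul_eq_mul, ← mk_mul, ← map_smul, smul_mul_assoc]

instance : SMulCommClass ℂ (Level p l) (Level p l) where
  smul_comm c a b := by
    obtain ⟨a, rfl⟩ := mk_surjective p l a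
    obtain ⟨b, rfl⟩ := mk_surjective p l b
    simp only [smul_eq_mul, ← mk_mul, ← map_smul, mul_smul_comm]

instance : Star (Level p l) where
  star := Quotient.map' star fun a b hab => by
    rw [Submodule.quotientRel_def] at hab ⊢
    change p l (a - b) = 0 at hab
    change p l (star a - star b) = 0
    rw [← star_sub, seminorm_star, hab]

theorem mk_star (a : A) : mk p l (star a) = star (mk p l a) := rfl

instance : StarRing (Level p l) where
  star_involutive a := by
    obtain ⟨a, rfl⟩ := mk_surjective p l a
    simp only [← mk_star, star_star]
  star_mul a b := by
    obtain ⟨a, rfl⟩ := mk_surjective p l a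
    obtain ⟨b, rfl⟩ := mk_surjective p l b
    simp only [← mk_star, ← mk_mul, star_mul]
  star_add a b := by
    obtain ⟨a, rfl⟩ := mk_surjective p l a
    obtain ⟨b, rfl⟩ := mk_surjective p l b
    simp only [← mk_star, ← map_add, star_add]

instance : StarModule ℂ (Level p l) where
  star_smul c a := by
    obtain ⟨a, rfl⟩ := mk_surjective p l a
    simp only [← mk_star, ← map_smul, star_smul]

/-- The norm `‖a + N_l‖ = p_l(a)` of `A_l`, as a family that is indexed by one point. -/
def norm : Unit → Seminorm ℂ (Level p l) := fun _ =>
  Seminorm.of (Quotient.lift (p l) fun a b hab => by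
      have hab' : p l (a - b) = 0 := (Submodule.quotientRel_def (nullIdeal p l)).1 hab
      have h := abs_sub_map_le_sub (p l) a b
      rw [hab'] at h
      exact sub_eq_zero.1 (abs_eq_zero.1 (le_antisymm h (abs_nonneg _))))
    (fun a b => by
      obtain ⟨a, rfl⟩ := mk_surjective p l a
      obtain ⟨b, rfl⟩ := mk_surjective p l b
      exact map_add_le_add (p l) a b)
    (fun c a => by
      obtain ⟨a, rfl⟩ := mk_surjective p l a
      exact map_smul_eq_mul (p l) c a)

theorem norm_mk (u : Unit) (a : A) : norm p l u (mk p l a) = p l a := rfl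

instance : CStarFamily (norm p l) where
  mul_le u a b := by
    obtain ⟨a, rfl⟩ := mk_surjective p l a
    obtain ⟨b, rfl⟩ := mk_surjective p l b
    simp only [← mk_mul, norm_mk]
    exact CStarFamily.mul_le l a b
  star_mul_self u a := by
    obtain ⟨a, rfl⟩ := mk_surjective p l a
    simp only [← mk_mul, ← mk_star, norm_mk]
    exact CStarFamily.star_mul_self l a

end Level

/-- A normed `⋆`-algebra with the `C⋆`-identity embeds isometrically into a `C⋆`-algebra. -/
theorem exists_completion (U : Type u) [NormedRing U] [NormedAlgebra ℂ U] [StarRing U]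
    [CStarRing U] [StarModule ℂ U] :
    ∃ (C : Type u) (_ : CStarAlgebra C) (ι : U →⋆ₙₐ[ℂ] C), ∀ a, ‖ι a‖ = ‖a‖ := by
  have hs : UniformContinuous (star : U → U) :=
    (starₗᵢ ℂ : U ≃ₗᵢ⋆[ℂ] U).isometry.uniformContinuous
  let : NormedAlgebra ℂ (UniformSpace.Completion U) :=
    { UniformSpace.Completion.algebra U ℂ with
      norm_smul_le := fun c a => norm_smul_le c a }
  have hsc : Continuous (UniformSpace.Completion.map (star : U → U)) :=
    UniformSpace.Completion.continuous_map
  have hcoe : ∀ a : U, UniformSpace.Completion.map star (a : UniformSpace.Completion U) =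
      ((star a : U) : UniformSpace.Completion U) := UniformSpace.Completion.map_coe hs
  let : StarRing (UniformSpace.Completion U) :=
    { star := UniformSpace.Completion.map star
      star_involutive := by
        intro a
        refine UniformSpace.Completion.induction_on a ?_ fun a => ?_
        · exact isClosed_eq (hsc.comp hsc) continuous_id
        · rw [hcoe, hcoe, star_star]
      star_mul := by
        intro a b
        refine UniformSpace.Completion.induction_on₂ a b ?_ fun a b => ?_
        · exact isClosed_eq (hsc.comp continuous_mul)
            ((hsc.comp continuous_snd).mul (hsc.comp continuous_fst))
        · rw [← UniformSpace.Completion.coe_mul, hcoe, hcoe, hcoe, star_mul,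
            UniformSpace.Completion.coe_mul]
      star_add := by
        intro a b
        refine UniformSpace.Completion.induction_on₂ a b ?_ fun a b => ?_
        · exact isClosed_eq (hsc.comp continuous_add)
            ((hsc.comp continuous_fst).add (hsc.comp continuous_snd))
        · rw [← UniformSpace.Completion.coe_add, hcoe, hcoe, hcoe, star_add,
            UniformSpace.Completion.coe_add] }
  have hst : ∀ a : U, star (a : UniformSpace.Completion U) =
      ((star a : U) : UniformSpace.Completion U) := hcoe
  have : CStarRing (UniformSpace.Completion U) :=
    { norm_mul_self_le := by
        intro a
        refine UniformSpace.Completion.induction_on a ?_ fun a => ?_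
        · exact isClosed_le (continuous_norm.mul continuous_norm)
            (continuous_norm.comp (hsc.mul continuous_id))
        · rw [hst, ← UniformSpace.Completion.coe_mul, UniformSpace.Completion.norm_coe,
            UniformSpace.Completion.norm_coe]
          exact CStarRing.norm_mul_self_le a }
  have : StarModule ℂ (UniformSpace.Completion U) :=
    { star_smul := by
        intro c a
        refine UniformSpace.Completion.induction_on a ?_ fun a => ?_
        · exact isClosed_eq (hsc.comp (continuous_const_smul c)) (hsc.const_smul (star c))
        · rw [← UniformSpace.Completion.coe_smul, hst, hst, star_smul,
            UniformSpace.Completion.coe_smul] }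
  exact ⟨UniformSpace.Completion U, { },
    { toFun := fun a => a
      map_smul' := fun c a => UniformSpace.Completion.coe_smul c a
      map_zero' := UniformSpace.Completion.coe_zero
      map_add' := UniformSpace.Completion.coe_add
      map_mul' := UniformSpace.Completion.coe_mul
      map_star' := fun a => (hst a).symm }, UniformSpace.Completion.norm_coe⟩

/-- A `C⋆`-seminorm is the pullback of the norm of a unital `C⋆`-algebra. -/
theorem exists_rep (p : Λ → Seminorm ℂ A) [CStarFamily p] (l : Λ) :
    ∃ (C : Type u) (_ : CStarAlgebra C) (ι : A →⋆ₙₐ[ℂ] C), ∀ a, ‖ι a‖ = p l a := by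
  let nB : NormedAddCommGroup (Level p l) :=
    AddGroupNorm.toNormedAddCommGroup
      { toFun := Level.norm p l ()
        map_zero' := map_zero _
        add_le' := map_add_le_add _
        neg' := map_neg_eq_map _
        eq_zero_of_map_eq_zero' := fun a ha => by
          obtain ⟨a, rfl⟩ := Level.mk_surjective p l a
          exact Level.mk_eq_zero.2 ha }
  let : NonUnitalNormedRing (Level p l) :=
    { nB, (inferInstance : NonUnitalRing (Level p l)) with
      norm_mul_le := CStarFamily.mul_le (p := Level.norm p l) () }
  let : NormedSpace ℂ (Level p l) :=
    { norm_smul_le := fun c a => (map_smul_eq_mul (Level.norm p l ()) c a).le }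
  have : CStarRing (Level p l) :=
    { norm_mul_self_le := fun a => by
        have h := CStarFamily.star_mul_self (p := Level.norm p l) () a
        rw [sq] at h
        exact h.ge }
  obtain ⟨C, hC, ι, hι⟩ := exists_completion (Unitization ℂ (Level p l))
  refine ⟨C, hC, (ι.comp (Unitization.inrNonUnitalStarAlgHom ℂ (Level p l))).comp
    { toFun := Level.mk p l
      map_smul' := map_smul _
      map_zero' := map_zero _
      map_add' := map_add _
      map_mul' := Level.mk_mul p l
      map_star' := Level.mk_star p l }, fun a => ?_⟩
  change ‖ι ((Level.mk p l a : Level p l) : Unitization ℂ (Level p l))‖ = p l a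
  rw [hι, Unitization.norm_inr]
  rfl

end Algebra

section Modules

set_option linter.unusedSectionVars false

variable {Λ : Type*} {A : Type u} [NonUnitalRing A] [StarRing A] [Module ℂ A]
  [IsScalarTower ℂ A A] [SMulCommClass ℂ A A] [StarModule ℂ A]
variable {X : Type*} [AddCommGroup X] [Module ℂ X]

/-- A right `A`-module `X` with an `A`-valued inner product, conjugate linear in the first and
linear in the second variable. Positivity of `a` means `a = b⋆b` for some `b`.
The family `p` of seminorms of `A` is a parameter because it topologizes `X` and its operators. -/
structure InnerModule (p : Λ → Seminorm ℂ A) (X : Type*) [AddCommGroup X] [Module ℂ X] where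
  /-- the right action `(x, a) ↦ x a` -/
  rmul : X →ₗ[ℂ] A →ₗ[ℂ] X
  rmul_mul : ∀ x a b, rmul x (a * b) = rmul (rmul x a) b
  /-- the inner product `⟨x, y⟩_A` -/
  inner : X →ₗ⋆[ℂ] X →ₗ[ℂ] A
  inner_rmul : ∀ x y a, inner x (rmul y a) = inner x y * a
  star_inner : ∀ x y, star (inner x y) = inner y x
  inner_self_nonneg : ∀ x, ∃ b, inner x x = star b * b
  inner_self_eq_zero : ∀ x, inner x x = 0 → x = 0

/-- Completeness of `X` with respect to the topology that is given by the seminorms `q l`: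
every Cauchy filter converges. -/
def CompleteFor (q : Λ → X → ℝ) : Prop :=
  ∀ F : Filter X, F.NeBot →
    (∀ l, ∀ ε > 0, ∃ s ∈ F, ∀ x ∈ s, ∀ y ∈ s, q l (x - y) < ε) →
    ∃ x, ∀ l, ∀ ε > 0, ∀ᶠ y in F, q l (y - x) < ε

theorem continuousAdd_of_edist {M : Type*} [AddCommGroup M] (d : PseudoEMetricSpace M)
    (h : ∀ a b c e : M, edist (a + b) (c + e) ≤ edist a c + edist b e) :
    @ContinuousAdd M d.toUniformSpace.toTopologicalSpace _ := by
  refine ⟨LipschitzWith.continuous (K := 2) fun x y => ?_⟩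
  refine (h _ _ _ _).trans ?_
  rw [ENNReal.coe_ofNat, two_mul]
  exact add_le_add (le_max_left _ _) (le_max_right _ _)

namespace InnerModule

variable {p : Λ → Seminorm ℂ A} (E : InnerModule p X)

/-- The seminorm `p_l^A(x) = p_l(⟨x, x⟩_A)^{1/2}` on `X`. -/
def seminorm (l : Λ) (x : X) : ℝ := √(p l (E.inner x x))

theorem seminorm_nonneg (l : Λ) (x : X) : 0 ≤ E.seminorm l x := Real.sqrt_nonneg _

theorem seminorm_sq (l : Λ) (x : X) : E.seminorm l x ^ 2 = p l (E.inner x x) :=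
  Real.sq_sqrt (apply_nonneg _ _)

theorem ext_inner {x y : X} (h : ∀ z, E.inner z x = E.inner z y) : x = y := by
  rw [← sub_eq_zero]
  apply E.inner_self_eq_zero
  rw [map_sub, h, sub_self]

theorem rmul_inner (x y : X) (a : A) : E.inner (E.rmul x a) y = star a * E.inner x y := by
  rw [← E.star_inner, E.inner_rmul, star_mul, E.star_inner]

/-- The algebra `L_A(X)` of adjointable module morphisms `X → X`. -/
def operators : Subalgebra ℂ (Module.End ℂ X) where
  carrier := {T | (∀ x a, T (E.rmul x a) = E.rmul (T x) a) ∧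
    ∃ S : Module.End ℂ X, (∀ x a, S (E.rmul x a) = E.rmul (S x) a) ∧
      ∀ x y, E.inner (T x) y = E.inner x (S y)}
  mul_mem' := by
    rintro T T' ⟨hT, S, hS, h⟩ ⟨hT', S', hS', h'⟩
    refine ⟨fun x a => ?_, S' * S, fun x a => ?_, fun x y => ?_⟩
    · simp only [Module.End.mul_apply, hT', hT]
    · simp only [Module.End.mul_apply, hS', hS]
    · simp only [Module.End.mul_apply, h', h]
  add_mem' := by
    rintro T T' ⟨hT, S, hS, h⟩ ⟨hT', S', hS', h'⟩
    refine ⟨fun x a => ?_, S + S', fun x a => ?_, fun x y => ?_⟩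
    · simp only [LinearMap.add_apply, map_add, hT', hT]
    · simp only [LinearMap.add_apply, map_add, hS', hS]
    · simp only [LinearMap.add_apply, map_add, h', h]
  algebraMap_mem' c := by
    refine ⟨fun x a => ?_, algebraMap ℂ _ (star c), fun x a => ?_, fun x y => ?_⟩ <;>
      simp [Module.algebraMap_end_apply]

/-- The type `L_A(X)`. -/
abbrev L := E.operators

instance : Star E.L where
  star T := ⟨T.2.2.choose, T.2.2.choose_spec.1, T.1, T.2.1, fun x y => by
    rw [← E.star_inner, ← T.2.2.choose_spec.2, E.star_inner]⟩

theorem inner_left (T : E.L) (x y : X) : E.inner (T.1 x) y = E.inner x ((star T).1 y) :=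
  T.2.2.choose_spec.2 x y

theorem eq_star {T S : E.L} (h : ∀ x y, E.inner (T.1 x) y = E.inner x (S.1 y)) : S = star T := by
  ext y
  exact E.ext_inner fun x => by rw [← h, E.inner_left]

theorem inner_right (T : E.L) (x y : X) : E.inner x (T.1 y) = E.inner ((star T).1 x) y := by
  rw [← E.star_inner, E.inner_left, E.star_inner]

instance : StarRing E.L where
  star_involutive T := (E.eq_star fun x y => (E.inner_right T x y).symm).symm
  star_mul T S := (E.eq_star fun x y => by
    change E.inner (T.1 (S.1 x)) y = E.inner x ((star S).1 ((star T).1 y))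
    rw [E.inner_left, E.inner_left]).symm
  star_add T S := (E.eq_star fun x y => by
    change E.inner (T.1 x + S.1 x) y = E.inner x ((star T).1 y + (star S).1 y)
    rw [map_add, map_add, LinearMap.add_apply, E.inner_left, E.inner_left]).symm

instance : StarModule ℂ E.L where
  star_smul c T := (E.eq_star fun x y => by
    change E.inner (c • T.1 x) y = E.inner x (star c • (star T).1 y)
    rw [map_smul (E.inner x), ← E.inner_left, LinearMap.map_smulₛₗ₂]
    rfl).symm

/-- The operator `θ_{y,x}(z) = y ⟨x, z⟩_A`. -/
def theta (y x : X) : E.L :=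
  ⟨E.rmul y ∘ₗ E.inner x,
    fun z a => by simp only [LinearMap.comp_apply, E.inner_rmul, E.rmul_mul],
    E.rmul x ∘ₗ E.inner y,
    fun z a => by simp only [LinearMap.comp_apply, E.inner_rmul, E.rmul_mul],
    fun z w => by
      simp only [LinearMap.comp_apply, E.inner_rmul, E.rmul_inner, E.star_inner]⟩

theorem theta_apply (y x z : X) : (E.theta y x).1 z = E.rmul y (E.inner x z) := rfl

theorem star_theta (y x : X) : star (E.theta y x) = E.theta x y :=
  (E.eq_star fun z w => by
    simp only [theta_apply, E.inner_rmul, E.rmul_inner, E.star_inner]).symm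

theorem mul_theta (T : E.L) (y x : X) : T * E.theta y x = E.theta (T.1 y) x :=
  Subtype.ext <| LinearMap.ext fun _ => T.2.1 _ _

/-- `Θ(X)`, the linear span of the operators `θ_{y,x}`. -/
def finiteRank : Submodule ℂ E.L := Submodule.span ℂ {T | ∃ y x, T = E.theta y x}

/-- `p_{l,L_A(X)}(T) = sup {p_l^A(T x) | p_l^A(x) ≤ 1}`, as an extended nonnegative number. -/
def opNorm (l : Λ) (T : E.L) : ℝ≥0∞ :=
  ⨆ (x : X) (_ : E.seminorm l x ≤ 1), ENNReal.ofReal (E.seminorm l (T.1 x))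

variable [CStarFamily p]

theorem cauchy_schwarz (l : Λ) (x y : X) :
    p l (E.inner x y) ≤ E.seminorm l x * E.seminorm l y := by
  obtain ⟨C, _, ι, hι⟩ := exists_rep p l
  let _ := CStarAlgebra.spectralOrder C
  have _ := CStarAlgebra.spectralOrderedRing C
  have hpos : ∀ z, 0 ≤ ι (E.inner z z) := fun z => by
    obtain ⟨b, hb⟩ := E.inner_self_nonneg z
    rw [hb, map_mul, map_star]
    exact star_mul_self_nonneg _
  have key : ∀ t : ℝ, p l (E.inner x x) < t →
      p l (E.inner x y) ^ 2 ≤ t * p l (E.inner y y) := by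
    intro t ht
    have ht0 : 0 < t := (apply_nonneg _ _).trans_lt ht
    have h1 := hpos (E.rmul x (E.inner x y) - (t : ℂ) • y)
    have h2 : ι (E.inner (E.rmul x (E.inner x y) - (t : ℂ) • y)
          (E.rmul x (E.inner x y) - (t : ℂ) • y)) =
        star (ι (E.inner x y)) * ι (E.inner x x) * ι (E.inner x y)
          - (t : ℂ) • (star (ι (E.inner x y)) * ι (E.inner x y))
          - ((t : ℂ) • (star (ι (E.inner x y)) * ι (E.inner x y))
          - (t : ℂ) • (t : ℂ) • ι (E.inner y y)) := by
      simp only [map_sub, LinearMap.sub_apply, map_smul, LinearMap.map_smulₛₗ₂, E.inner_rmul,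
        E.rmul_inner, map_mul, map_star, Complex.conj_ofReal, smul_sub, ← E.star_inner x y,
        smul_mul_assoc]
    rw [h2] at h1
    have h3 := CStarAlgebra.star_left_conjugate_le_norm_smul (a := ι (E.inner x y))
      (b := ι (E.inner x x)) (hb := IsSelfAdjoint.of_nonneg (hpos x))
    have h4 : ‖ι (E.inner x x)‖ • (star (ι (E.inner x y)) * ι (E.inner x y)) ≤
        t • (star (ι (E.inner x y)) * ι (E.inner x y)) :=
      smul_le_smul_of_nonneg_right (by rw [hι]; exact ht.le) (star_mul_self_nonneg _)
    simp only [Complex.coe_smul] at h1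
    have h5 : t • (star (ι (E.inner x y)) * ι (E.inner x y)) ≤ t • t • ι (E.inner y y) := by
      have h6 := h1.trans (sub_le_sub_right (sub_le_sub_right (h3.trans h4) _) _)
      rw [sub_self, zero_sub, neg_sub, sub_nonneg] at h6
      exact h6
    rw [smul_le_smul_iff_of_pos_left ht0] at h5
    have h7 := CStarAlgebra.norm_le_norm_of_nonneg_of_le (star_mul_self_nonneg _) h5
    rw [CStarRing.norm_star_mul_self, norm_smul, hι, hι, Real.norm_of_nonneg ht0.le] at h7
    rw [sq]
    exact h7
  have h : p l (E.inner x y) ^ 2 ≤ p l (E.inner x x) * p l (E.inner y y) := by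
    have hc : Filter.Tendsto (fun t : ℝ => t * p l (E.inner y y))
        (nhdsWithin (p l (E.inner x x)) (Set.Ioi (p l (E.inner x x))))
        (nhds (p l (E.inner x x) * p l (E.inner y y))) :=
      ((continuous_id.mul continuous_const).tendsto _).mono_left nhdsWithin_le_nhds
    exact ge_of_tendsto hc (Filter.eventually_of_mem self_mem_nhdsWithin key)
  rw [← E.seminorm_sq, ← E.seminorm_sq, ← mul_pow] at h
  exact le_of_sq_le_sq h (mul_nonneg (E.seminorm_nonneg _ _) (E.seminorm_nonneg _ _))

theorem seminorm_add_le (l : Λ) (x y : X) :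
    E.seminorm l (x + y) ≤ E.seminorm l x + E.seminorm l y := by
  have h : E.seminorm l (x + y) ^ 2 ≤ (E.seminorm l x + E.seminorm l y) ^ 2 := by
    rw [E.seminorm_sq, map_add (E.inner (x + y)), LinearMap.map_add₂, LinearMap.map_add₂]
    have h1 := map_add_le_add (p l) (E.inner x x + E.inner y x) (E.inner x y + E.inner y y)
    have h2 := map_add_le_add (p l) (E.inner x x) (E.inner y x)
    have h3 := map_add_le_add (p l) (E.inner x y) (E.inner y y)
    have h4 := E.cauchy_schwarz l x y
    have h5 := E.cauchy_schwarz l y x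
    have h6 := E.seminorm_sq l x
    have h7 := E.seminorm_sq l y
    nlinarith
  exact le_of_sq_le_sq h (add_nonneg (E.seminorm_nonneg _ _) (E.seminorm_nonneg _ _))

theorem seminorm_smul (l : Λ) (c : ℂ) (x : X) :
    E.seminorm l (c • x) = ‖c‖ * E.seminorm l x := by
  have h : E.seminorm l (c • x) ^ 2 = (‖c‖ * E.seminorm l x) ^ 2 := by
    rw [E.seminorm_sq, mul_pow, E.seminorm_sq, map_smul, LinearMap.map_smulₛₗ₂,
      map_smul_eq_mul, map_smul_eq_mul, RCLike.norm_conj]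
    ring
  exact (sq_eq_sq₀ (E.seminorm_nonneg _ _)
    (mul_nonneg (norm_nonneg _) (E.seminorm_nonneg _ _))).1 h

theorem seminorm_rmul_le (l : Λ) (x : X) (a : A) :
    E.seminorm l (E.rmul x a) ≤ E.seminorm l x * p l a := by
  have h : E.seminorm l (E.rmul x a) ^ 2 ≤ (E.seminorm l x * p l a) ^ 2 := by
    rw [E.seminorm_sq, E.inner_rmul, E.rmul_inner, mul_pow, E.seminorm_sq]
    have h1 := CStarFamily.mul_le (p := p) l (star a * E.inner x x) a
    have h2 := CStarFamily.mul_le (p := p) l (star a) (E.inner x x)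
    rw [seminorm_star] at h2
    nlinarith [apply_nonneg (p l) a]
  exact le_of_sq_le_sq h (mul_nonneg (E.seminorm_nonneg _ _) (apply_nonneg _ _))

theorem seminorm_apply_sq_le (l : Λ) (T : E.L) (x : X) :
    E.seminorm l (T.1 x) ^ 2 ≤ E.seminorm l x * E.seminorm l ((star T).1 (T.1 x)) := by
  rw [E.seminorm_sq, E.inner_left]
  exact E.cauchy_schwarz l _ _

theorem opNorm_le (l : Λ) (T : E.L) (C : NNReal)
    (h : ∀ x, E.seminorm l (T.1 x) ≤ C * E.seminorm l x) : E.opNorm l T ≤ C := by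
  refine iSup₂_le fun x hx => ?_
  rw [← ENNReal.ofReal_coe_nnreal]
  refine ENNReal.ofReal_le_ofReal ((h x).trans ?_)
  simpa using mul_le_mul_of_nonneg_left hx C.coe_nonneg

theorem le_of_opNorm (l : Λ) (T : E.L) (C : NNReal) (h : E.opNorm l T ≤ C) (x : X) :
    E.seminorm l (T.1 x) ≤ C * E.seminorm l x := by
  have h1 : ∀ x, E.seminorm l x ≤ 1 → E.seminorm l (T.1 x) ≤ C := fun x hx => by
    have h2 := (le_iSup₂ (f := fun (x : X) (_ : E.seminorm l x ≤ 1) =>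
      ENNReal.ofReal (E.seminorm l (T.1 x))) x hx).trans h
    rw [← ENNReal.ofReal_coe_nnreal] at h2
    exact (ENNReal.ofReal_le_ofReal_iff C.coe_nonneg).1 h2
  rcases (E.seminorm_nonneg l x).eq_or_lt with h0 | h0
  · have h3 := E.seminorm_apply_sq_le l T x
    rw [← h0, zero_mul] at h3
    rw [← h0, mul_zero]
    nlinarith [E.seminorm_nonneg l (T.1 x)]
  · have h3 := h1 (((E.seminorm l x)⁻¹ : ℝ) • x) (by
      rw [← Complex.coe_smul, E.seminorm_smul, Complex.norm_real,
        Real.norm_of_nonneg (inv_nonneg.2 h0.le), inv_mul_cancel₀ h0.ne'])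
    rw [← Complex.coe_smul, map_smul, E.seminorm_smul, Complex.norm_real,
      Real.norm_of_nonneg (inv_nonneg.2 h0.le), inv_mul_le_iff₀ h0, mul_comm] at h3
    exact h3

theorem opNorm_zero (l : Λ) : E.opNorm l 0 = 0 :=
  le_antisymm (E.opNorm_le l 0 0 fun x => by simp [seminorm]) zero_le

theorem opNorm_add_le (l : Λ) (T S : E.L) :
    E.opNorm l (T + S) ≤ E.opNorm l T + E.opNorm l S := by
  refine iSup₂_le fun x hx => ?_
  refine (ENNReal.ofReal_le_ofReal (E.seminorm_add_le l (T.1 x) (S.1 x))).trans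
    (ENNReal.ofReal_add_le.trans ?_)
  gcongr
  · exact le_iSup₂ (f := fun (x : X) (_ : E.seminorm l x ≤ 1) =>
      ENNReal.ofReal (E.seminorm l (T.1 x))) x hx
  · exact le_iSup₂ (f := fun (x : X) (_ : E.seminorm l x ≤ 1) =>
      ENNReal.ofReal (E.seminorm l (S.1 x))) x hx

theorem opNorm_mul_le (l : Λ) (T S : E.L) (C : NNReal)
    (h : E.opNorm l T ≤ C) : E.opNorm l (T * S) ≤ C * E.opNorm l S := by
  refine iSup₂_le fun x hx => ?_
  refine (ENNReal.ofReal_le_ofReal (E.le_of_opNorm l T C h (S.1 x))).trans ?_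
  rw [ENNReal.ofReal_mul C.coe_nonneg, ENNReal.ofReal_coe_nnreal]
  gcongr
  exact le_iSup₂ (f := fun (x : X) (_ : E.seminorm l x ≤ 1) =>
      ENNReal.ofReal (E.seminorm l (S.1 x))) x hx

theorem opNorm_smul_le (l : Λ) (c : ℂ) (T : E.L) :
    E.opNorm l (c • T) ≤ ‖c‖₊ * E.opNorm l T := by
  refine iSup₂_le fun x hx => ?_
  change ENNReal.ofReal (E.seminorm l (c • T.1 x)) ≤ _
  rw [E.seminorm_smul, ENNReal.ofReal_mul (norm_nonneg _), ofReal_norm]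
  refine mul_le_mul_right (a := ‖c‖ₑ) ?_
  exact le_iSup₂ (f := fun (x : X) (_ : E.seminorm l x ≤ 1) =>
      ENNReal.ofReal (E.seminorm l (T.1 x))) x hx

theorem opNorm_neg (l : Λ) (T : E.L) : E.opNorm l (-T) = E.opNorm l T := by
  have key : ∀ T : E.L, E.opNorm l (-T) ≤ E.opNorm l T := fun T => by
    simpa using E.opNorm_smul_le l (-1) T
  exact le_antisymm (key T) (by simpa using key (-T))

theorem opNorm_star (l : Λ) (T : E.L) : E.opNorm l (star T) = E.opNorm l T := by
  have key : ∀ T : E.L, E.opNorm l (star T) ≤ E.opNorm l T := by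
    intro T
    rcases eq_or_ne (E.opNorm l T) ⊤ with h | h
    · rw [h]; exact le_top
    · obtain ⟨C, hC⟩ := WithTop.ne_top_iff_exists.1 h
      rw [← hC]
      refine E.opNorm_le l _ C fun x => ?_
      have h1 := E.seminorm_apply_sq_le l (star T) x
      have h2 := E.le_of_opNorm l T C hC.ge ((star T).1 x)
      rw [star_star] at h1
      rcases (E.seminorm_nonneg l ((star T).1 x)).eq_or_lt with h0 | h0
      · rw [← h0]; exact mul_nonneg C.coe_nonneg (E.seminorm_nonneg _ _)
      · have h3 := mul_le_mul_of_nonneg_left h2 (E.seminorm_nonneg l x)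
        nlinarith
  exact le_antisymm (key T) (by simpa using key (star T))

/-- The distance `p_{l,L_A(X)}(T - S)` on `L_A(X)`. -/
@[reducible]
def opDist (l : Λ) : PseudoEMetricSpace E.L where
  edist T S := E.opNorm l (T - S)
  edist_self T := by rw [sub_self, E.opNorm_zero]
  edist_comm T S := by rw [← E.opNorm_neg, neg_sub]
  edist_triangle T S R := by
    rw [← sub_add_sub_cancel T S R]
    exact E.opNorm_add_le l _ _

/-- The topology of `L_A(X)` given by the family of seminorms `p_{l,L_A(X)}`. -/
instance : TopologicalSpace E.L :=
  ⨅ l, (E.opDist l).toUniformSpace.toTopologicalSpace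

/-- A map that is Lipschitz for each of the seminorms is continuous. -/
theorem continuous_of_lipschitz (f : E.L → E.L) (h : ∀ l, ∃ C : NNReal, ∀ T S,
    E.opNorm l (f T - f S) ≤ C * E.opNorm l (T - S)) : Continuous f := by
  refine continuous_iInf_rng.2 fun l => continuous_iInf_dom (i := l) ?_
  obtain ⟨C, hC⟩ := h l
  exact @LipschitzWith.continuous _ _ (E.opDist l) (E.opDist l) C f hC

instance : ContinuousAdd E.L :=
  continuousAdd_iInf fun l => continuousAdd_of_edist (E.opDist l) fun a b c d => by
    change E.opNorm l (a + b - (c + d)) ≤ _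
    rw [add_sub_add_comm]
    exact E.opNorm_add_le l _ _

instance : ContinuousConstSMul ℂ E.L where
  continuous_const_smul c := E.continuous_of_lipschitz _ fun l => ⟨‖c‖₊, fun T S => by
    rw [← smul_sub]
    exact E.opNorm_smul_le l c _⟩

theorem continuous_star : Continuous (star : E.L → E.L) :=
  E.continuous_of_lipschitz _ fun l => ⟨1, fun T S => by
    rw [show star T - star S = star (T - S) from (star_sub T S).symm, E.opNorm_star,
      ENNReal.coe_one, one_mul]⟩

theorem opNorm_ne_top_of_mem_closure {T : E.L} (hT : T ∈ closure (E.finiteRank : Set E.L))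
    (l : Λ) : E.opNorm l T ≠ ⊤ := by
  have h1 : ∀ S ∈ E.finiteRank, E.opNorm l S ≠ ⊤ := by
    intro S hS
    refine Submodule.span_induction ?_ ?_ ?_ ?_ hS
    · rintro _ ⟨y, x, rfl⟩
      refine ne_top_of_le_ne_top ENNReal.coe_ne_top (E.opNorm_le l _
        ⟨E.seminorm l y * E.seminorm l x,
          mul_nonneg (E.seminorm_nonneg _ _) (E.seminorm_nonneg _ _)⟩ fun z => ?_)
      refine (E.seminorm_rmul_le l y _).trans ?_
      change _ ≤ E.seminorm l y * E.seminorm l x * E.seminorm l z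
      rw [mul_assoc]
      exact mul_le_mul_of_nonneg_left (E.cauchy_schwarz l x z) (E.seminorm_nonneg _ _)
    · rw [E.opNorm_zero]; exact ENNReal.zero_ne_top
    · intro T S _ _ hT hS
      exact ne_top_of_le_ne_top (ENNReal.add_ne_top.2 ⟨hT, hS⟩) (E.opNorm_add_le l T S)
    · intro c T _ hT
      exact ne_top_of_le_ne_top (ENNReal.mul_ne_top ENNReal.coe_ne_top hT)
        (E.opNorm_smul_le l c T)
  let _ := E.opDist l
  have h2 : T ∈ @closure _ (E.opDist l).toUniformSpace.toTopologicalSpace E.finiteRank :=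
    closure.mono (iInf_le _ l) hT
  obtain ⟨S, hS, hd⟩ := EMetric.mem_closure_iff.1 h2 1 one_pos
  have h3 := E.opNorm_add_le l (T - S) S
  rw [sub_add_cancel] at h3
  exact ne_top_of_le_ne_top (ENNReal.add_ne_top.2 ⟨(hd.trans ENNReal.one_lt_top).ne, h1 S hS⟩) h3

/-- `K_A(X)`, the closure of `Θ(X)` in `L_A(X)`. -/
def compacts : NonUnitalStarSubalgebra ℂ E.L :=
  { E.finiteRank.topologicalClosure with
    mul_mem' := by
      intro T S hT hS
      change T * S ∈ closure (E.finiteRank : Set E.L)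
      have hc : Continuous (fun R : E.L => T * R) := by
        refine E.continuous_of_lipschitz _ fun l => ?_
        obtain ⟨C, hC⟩ := WithTop.ne_top_iff_exists.1 (E.opNorm_ne_top_of_mem_closure hT l)
        refine ⟨C, fun R R' => ?_⟩
        rw [← mul_sub]
        exact E.opNorm_mul_le l T _ C hC.ge
      refine map_mem_closure hc hS fun R hR => ?_
      refine Submodule.span_induction ?_ ?_ ?_ ?_ hR
      · rintro _ ⟨y, x, rfl⟩
        exact Submodule.subset_span ⟨_, _, E.mul_theta T y x⟩
      · rw [mul_zero]; exact zero_mem _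
      · intro R R' _ _ h h'
        rw [mul_add]; exact add_mem h h'
      · intro c R _ h
        rw [mul_smul_comm]; exact Submodule.smul_mem _ c h
    star_mem' := by
      intro T hT
      refine map_mem_closure E.continuous_star hT fun R hR => ?_
      refine Submodule.span_induction ?_ ?_ ?_ ?_ hR
      · rintro _ ⟨y, x, rfl⟩
        exact Submodule.subset_span ⟨_, _, E.star_theta y x⟩
      · rw [star_zero]; exact zero_mem _
      · intro R R' _ _ h h'
        rw [star_add]; exact add_mem h h'
      · intro c R _ h
        rw [star_smul]; exact Submodule.smul_mem _ _ h }

end InnerModule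

end Modules

section Localization

set_option linter.unusedSectionVars false

variable {Λ : Type*} {A : Type u} [NonUnitalRing A] [StarRing A] [Module ℂ A]
  [IsScalarTower ℂ A A] [SMulCommClass ℂ A A] [StarModule ℂ A]
variable {X : Type*} [AddCommGroup X] [Module ℂ X]

namespace InnerModule

variable {p : Λ → Seminorm ℂ A} [CStarFamily p] (E : InnerModule p X) (l : Λ)

/-- The kernel `{x | p_l^A(x) = 0}` of the seminorm `p_l^A`. -/
def nullSpace : Submodule ℂ X where
  carrier := {x | E.seminorm l x = 0}
  zero_mem' := by
    rw [Set.mem_ofPred_eq, seminorm, map_zero, map_zero, Real.sqrt_zero]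
  add_mem' {x y} hx hy := by
    rw [Set.mem_ofPred_eq] at *
    have h := E.seminorm_add_le l x y
    rw [hx, hy, add_zero] at h
    exact le_antisymm h (E.seminorm_nonneg _ _)
  smul_mem' c x hx := by
    rw [Set.mem_ofPred_eq] at *
    rw [E.seminorm_smul, hx, mul_zero]

theorem mem_nullSpace {x : X} : x ∈ E.nullSpace l ↔ E.seminorm l x = 0 := Iff.rfl

theorem inner_mem_left {x : X} (hx : x ∈ E.nullSpace l) (y : X) : p l (E.inner x y) = 0 := by
  have h := E.cauchy_schwarz l x y
  rw [(E.mem_nullSpace l).1 hx, zero_mul] at h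
  exact le_antisymm h (apply_nonneg _ _)

theorem inner_mem_right (x : X) {y : X} (hy : y ∈ E.nullSpace l) : p l (E.inner x y) = 0 := by
  rw [← E.star_inner, seminorm_star]
  exact E.inner_mem_left l hy x

theorem rmul_mem_left {x : X} (hx : x ∈ E.nullSpace l) (a : A) : E.rmul x a ∈ E.nullSpace l := by
  have h := E.seminorm_rmul_le l x a
  rw [(E.mem_nullSpace l).1 hx, zero_mul] at h
  exact le_antisymm h (E.seminorm_nonneg _ _)

theorem rmul_mem_right (x : X) {a : A} (ha : p l a = 0) : E.rmul x a ∈ E.nullSpace l := by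
  have h := E.seminorm_rmul_le l x a
  rw [ha, mul_zero] at h
  exact le_antisymm h (E.seminorm_nonneg _ _)

/-- The quotient `X_l = X / ker p_l^A` as an inner product module over `A_l`:
`σ_l(x) π_l(a) = σ_l(x a)` and `⟨σ_l(x), σ_l(y)⟩ = π_l(⟨x, y⟩)`. -/
def level : InnerModule (Level.norm p l) (X ⧸ E.nullSpace l) where
  rmul := lift₂ (E.nullSpace l) (nullIdeal p l) (E.rmul.compr₂ (E.nullSpace l).mkQ)
    (fun x hx a => (Submodule.Quotient.mk_eq_zero _).2 (E.rmul_mem_left l hx a))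
    (fun x a ha => (Submodule.Quotient.mk_eq_zero _).2 (E.rmul_mem_right l x ha))
  rmul_mul x a b := by
    obtain ⟨x, rfl⟩ := (E.nullSpace l).mkQ_surjective x
    obtain ⟨a, rfl⟩ := Level.mk_surjective p l a
    obtain ⟨b, rfl⟩ := Level.mk_surjective p l b
    exact congrArg (E.nullSpace l).mkQ (E.rmul_mul x a b)
  inner := lift₂ (E.nullSpace l) (E.nullSpace l) (E.inner.compr₂ₛₗ (Level.mk p l))
    (fun x hx y => Level.mk_eq_zero.2 (E.inner_mem_left l hx y))
    (fun x y hy => Level.mk_eq_zero.2 (E.inner_mem_right l x hy))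
  inner_rmul x y a := by
    obtain ⟨x, rfl⟩ := (E.nullSpace l).mkQ_surjective x
    obtain ⟨y, rfl⟩ := (E.nullSpace l).mkQ_surjective y
    obtain ⟨a, rfl⟩ := Level.mk_surjective p l a
    exact congrArg (Level.mk p l) (E.inner_rmul x y a)
  star_inner x y := by
    obtain ⟨x, rfl⟩ := (E.nullSpace l).mkQ_surjective x
    obtain ⟨y, rfl⟩ := (E.nullSpace l).mkQ_surjective y
    exact congrArg (Level.mk p l) (E.star_inner x y)
  inner_self_nonneg x := by
    obtain ⟨x, rfl⟩ := (E.nullSpace l).mkQ_surjective x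
    obtain ⟨b, hb⟩ := E.inner_self_nonneg x
    exact ⟨Level.mk p l b, congrArg (Level.mk p l) hb⟩
  inner_self_eq_zero x hx := by
    obtain ⟨x, rfl⟩ := (E.nullSpace l).mkQ_surjective x
    have h : p l (E.inner x x) = 0 := Level.mk_eq_zero.1 hx
    refine (Submodule.Quotient.mk_eq_zero _).2 ((E.mem_nullSpace l).2 ?_)
    rw [seminorm, h, Real.sqrt_zero]

theorem apply_mem_nullSpace (T : E.L) {x : X} (hx : x ∈ E.nullSpace l) :
    T.1 x ∈ E.nullSpace l := by
  have h := E.seminorm_apply_sq_le l T x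
  rw [(E.mem_nullSpace l).1 hx, zero_mul] at h
  exact pow_eq_zero_iff two_ne_zero |>.1 (le_antisymm h (sq_nonneg _))

/-- The operator on `X_l` that is induced by an adjointable operator on `X`. -/
def levelOp (T : E.L) : (E.level l).L :=
  ⟨(E.nullSpace l).mapQ (E.nullSpace l) T.1 fun _ hx => E.apply_mem_nullSpace l T hx,
    fun x a => by
      obtain ⟨x, rfl⟩ := (E.nullSpace l).mkQ_surjective x
      obtain ⟨a, rfl⟩ := Level.mk_surjective p l a
      exact congrArg (E.nullSpace l).mkQ (T.2.1 x a),
    (E.nullSpace l).mapQ (E.nullSpace l) (star T).1 fun _ hx => E.apply_mem_nullSpace l _ hx,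
    fun x a => by
      obtain ⟨x, rfl⟩ := (E.nullSpace l).mkQ_surjective x
      obtain ⟨a, rfl⟩ := Level.mk_surjective p l a
      exact congrArg (E.nullSpace l).mkQ ((star T).2.1 x a),
    fun x y => by
      obtain ⟨x, rfl⟩ := (E.nullSpace l).mkQ_surjective x
      obtain ⟨y, rfl⟩ := (E.nullSpace l).mkQ_surjective y
      exact congrArg (Level.mk p l) (E.inner_left T x y)⟩

theorem levelOp_mkQ (T : E.L) (x : X) :
    (E.levelOp l T).1 ((E.nullSpace l).mkQ x) = (E.nullSpace l).mkQ (T.1 x) := rfl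

theorem level_ext {T S : (E.level l).L}
    (h : ∀ x, T.1 ((E.nullSpace l).mkQ x) = S.1 ((E.nullSpace l).mkQ x)) : T = S :=
  Subtype.ext (Submodule.linearMap_qext _ (LinearMap.ext h))

/-- The canonical map `π_l : L_A(X) → L_{A_l}(X_l)`, `π_l(T)(σ_l(x)) = σ_l(T x)`. -/
def localize : E.L →⋆ₙₐ[ℂ] (E.level l).L where
  toFun := E.levelOp l
  map_smul' c T := E.level_ext l fun _ => rfl
  map_zero' := E.level_ext l fun _ => rfl
  map_add' T S := E.level_ext l fun _ => rfl
  map_mul' T S := E.level_ext l fun _ => rfl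
  map_star' T := (E.level l).eq_star fun x y => by
    obtain ⟨x, rfl⟩ := (E.nullSpace l).mkQ_surjective x
    obtain ⟨y, rfl⟩ := (E.nullSpace l).mkQ_surjective y
    exact congrArg (Level.mk p l) (E.inner_left T x y)

end InnerModule

end Localization

section Correspondences

set_option linter.unusedSectionVars false

variable {Λ : Type*} {A : Type u} [NonUnitalRing A] [StarRing A] [Module ℂ A]
  [IsScalarTower ℂ A A] [SMulCommClass ℂ A A] [StarModule ℂ A]
  [UniformSpace A] [IsUniformAddGroup A]
variable {X : Type*} [AddCommGroup X] [Module ℂ X]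

/-- A Hilbert pro-`C⋆`-module over `A`. -/
structure HilbertModule (p : Λ → Seminorm ℂ A) (X : Type*) [AddCommGroup X] [Module ℂ X]
    extends InnerModule p X where
  complete : CompleteFor toInnerModule.seminorm

/-- A pro-`C⋆`-correspondence `(X, A, φ)`: a Hilbert pro-`C⋆`-module `X` over `A` and a
continuous `⋆`-morphism `φ : A → L_A(X)`. -/
structure Correspondence (p : Λ → Seminorm ℂ A) [ProCStarAlgebra p] (X : Type*)
    [AddCommGroup X] [Module ℂ X] extends HilbertModule p X where
  φ : A →⋆ₙₐ[ℂ] toInnerModule.L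
  continuous_φ : Continuous φ

namespace Correspondence

variable {p : Λ → Seminorm ℂ A} [ProCStarAlgebra p] (E : Correspondence p X)

/-- `J_X^l`: all `a` with `π_l(φ(a)) ∈ K_{A_l}(X_l)` and `π_l(ab) = 0` for all
`b ∈ ker (π_l ∘ φ)`. -/
def JLevel (l : Λ) : NonUnitalStarSubalgebra ℂ A where
  carrier := {a | E.localize l (E.φ a) ∈ (E.level l).compacts ∧
    ∀ b, E.localize l (E.φ b) = 0 → Level.mk p l (a * b) = 0}
  zero_mem' := by
    refine ⟨?_, fun b _ => ?_⟩
    · rw [map_zero, map_zero]; exact zero_mem _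
    · rw [zero_mul, map_zero]
  add_mem' {a b} ha hb := by
    refine ⟨?_, fun c hc => ?_⟩
    · rw [map_add, map_add]; exact add_mem ha.1 hb.1
    · rw [add_mul, map_add, ha.2 c hc, hb.2 c hc, add_zero]
  mul_mem' {a b} ha hb := by
    refine ⟨?_, fun c hc => ?_⟩
    · rw [map_mul, map_mul]; exact mul_mem ha.1 hb.1
    · rw [mul_assoc, Level.mk_mul, hb.2 c hc, mul_zero]
  smul_mem' c a ha := by
    refine ⟨?_, fun b hb => ?_⟩
    · rw [map_smul, map_smul]; exact SMulMemClass.smul_mem c ha.1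
    · rw [smul_mul_assoc, map_smul, ha.2 b hb, smul_zero]
  star_mem' {a} ha := by
    refine ⟨?_, fun b hb => ?_⟩
    · rw [map_star, map_star]; exact star_mem ha.1
    · have h1 : Level.mk p l (a * (star a * b)) = 0 := ha.2 _ (by
        rw [map_mul, map_mul, hb, mul_zero])
      have h2 : p l (star (star a * b) * (star a * b)) = 0 := by
        rw [← Level.mk_eq_zero, star_mul, star_star, mul_assoc, Level.mk_mul, h1, mul_zero]
      rw [CStarFamily.star_mul_self] at h2
      exact Level.mk_eq_zero.2 (pow_eq_zero_iff two_ne_zero |>.1 h2)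

/-- `𝒥_X`, the intersection of all `J_X^l`. -/
def J : NonUnitalStarSubalgebra ℂ A := ⨅ l, E.JLevel l

end Correspondence

/-- A Hilbert `A`-`A` pro-`C⋆`-bimodule: a right Hilbert pro-`C⋆`-module over `A` that is also a
left Hilbert pro-`C⋆`-module over `A`, with `_A⟨x, y⟩ z = x ⟨y, z⟩_A` and contractive actions. -/
structure HilbertBimodule (p : Λ → Seminorm ℂ A) (X : Type*) [AddCommGroup X] [Module ℂ X]
    extends HilbertModule p X where
  /-- the left action `(a, x) ↦ a x` -/
  lmul : A →ₗ[ℂ] X →ₗ[ℂ] X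
  mul_lmul : ∀ a b x, lmul (a * b) x = lmul a (lmul b x)
  /-- the left inner product `_A⟨x, y⟩` -/
  linner : X →ₗ[ℂ] X →ₗ⋆[ℂ] A
  linner_lmul : ∀ a x y, linner (lmul a x) y = a * linner x y
  star_linner : ∀ x y, star (linner x y) = linner y x
  linner_self_nonneg : ∀ x, ∃ b, linner x x = star b * b
  linner_self_eq_zero : ∀ x, linner x x = 0 → x = 0
  lcomplete : CompleteFor fun l x => √(p l (linner x x))
  linner_lmul_eq : ∀ x y z, lmul (linner x y) z = rmul x (inner y z)
  seminorm_lmul_le : ∀ l a x, toInnerModule.seminorm l (lmul a x) ≤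
    p l a * toInnerModule.seminorm l x
  lseminorm_rmul_le : ∀ l a x, √(p l (linner (rmul x a) (rmul x a))) ≤
    p l a * √(p l (linner x x))

namespace HilbertBimodule

variable {p : Λ → Seminorm ℂ A} [ProCStarAlgebra p] (E : HilbertBimodule p X)

theorem lmul_linner (a : A) (x y : X) : E.linner x (E.lmul a y) = E.linner x y * star a := by
  rw [← E.star_linner, E.linner_lmul, star_mul, E.star_linner]

theorem inner_lmul (a : A) (x y : X) :
    E.inner (E.lmul a x) y = E.inner x (E.lmul (star a) y) := by
  have h1 : ∀ z, E.rmul z (E.inner (E.lmul a x) y) = E.rmul z (E.inner x (E.lmul (star a) y)) := by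
    intro z
    rw [← E.linner_lmul_eq, ← E.linner_lmul_eq, E.lmul_linner, E.mul_lmul]
  set c := E.inner (E.lmul a x) y - E.inner x (E.lmul (star a) y) with hc
  have h2 : ∀ z w, E.inner w z * c = 0 := by
    intro z w
    rw [← E.inner_rmul, hc, map_sub, h1, sub_self, map_zero]
  have h3 : star c * c = 0 := by
    nth_rewrite 1 [hc]
    rw [star_sub, E.star_inner, E.star_inner, sub_mul, h2, h2, sub_zero]
  have _ := ProCStarAlgebra.hausdorff (p := p)
  have h4 : ∀ l, p l c = 0 := by
    intro l
    have h5 := CStarFamily.star_mul_self (p := p) l c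
    rw [h3, map_zero] at h5
    exact pow_eq_zero_iff two_ne_zero |>.1 h5.symm
  have h6 : c = 0 := by
    by_contra hne
    obtain ⟨l, hl⟩ := (ProCStarAlgebra.withSeminorms (p := p)).separating_of_T1 c hne
    exact hl (h4 l)
  exact sub_eq_zero.1 h6

theorem lmul_rmul (a b : A) (x : X) : E.lmul a (E.rmul x b) = E.rmul (E.lmul a x) b := by
  refine E.ext_inner fun z => ?_
  rw [E.inner_rmul, ← star_star a, ← E.inner_lmul, ← E.inner_lmul, E.inner_rmul]

/-- The adjointable operator `x ↦ a x`. -/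
def leftOp (a : A) : E.L :=
  ⟨E.lmul a, fun x b => E.lmul_rmul a b x, E.lmul (star a), fun x b => E.lmul_rmul _ b x,
    E.inner_lmul a⟩

theorem leftOp_apply (a : A) (x : X) : (E.leftOp a).1 x = E.lmul a x := rfl

/-- A Hilbert `A`-`A` pro-`C⋆`-bimodule viewed as a pro-`C⋆`-correspondence, with
`φ(a) x = a x`. -/
def toCorrespondence : Correspondence p X where
  toHilbertModule := E.toHilbertModule
  φ :=
    { toFun := E.leftOp
      map_smul' := fun c a => Subtype.ext (map_smul E.lmul c a)
      map_zero' := Subtype.ext (map_zero E.lmul)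
      map_add' := fun a b => Subtype.ext (map_add E.lmul a b)
      map_mul' := fun a b => Subtype.ext (LinearMap.ext (E.mul_lmul a b))
      map_star' := fun a => E.eq_star (E.inner_lmul a) }
  continuous_φ := by
    refine continuous_iInf_rng.2 fun l => ?_
    let _ := E.opDist l
    refine EMetric.continuous_iff'.2 fun a ε hε => ?_
    have hc : Continuous fun b => ENNReal.ofReal (p l (b - a)) :=
      ENNReal.continuous_ofReal.comp (((ProCStarAlgebra.withSeminorms
        (p := p)).continuous_seminorm l).comp (continuous_id.sub continuous_const))
    have h0 := hc.tendsto a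
    rw [sub_self, map_zero, ENNReal.ofReal_zero] at h0
    filter_upwards [h0.eventually_lt_const hε] with b hb
    refine lt_of_le_of_lt ?_ hb
    change E.opNorm l (E.leftOp b - E.leftOp a) ≤ _
    rw [show E.leftOp b - E.leftOp a = E.leftOp (b - a) from
      Subtype.ext (map_sub E.lmul b a).symm]
    refine E.opNorm_le l _ (p l (b - a)).toNNReal fun x => ?_
    rw [Real.coe_toNNReal _ (apply_nonneg _ _)]
    exact E.seminorm_lmul_le l _ x

/-- The linear span of the left inner products. -/
def linnerSpan : Submodule ℂ A := Submodule.span ℂ {a | ∃ x y, a = E.linner x y}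

theorem mul_mem_linnerSpan (a : A) {b : A} (hb : b ∈ E.linnerSpan) : a * b ∈ E.linnerSpan := by
  refine Submodule.span_induction ?_ ?_ ?_ ?_ hb
  · rintro _ ⟨x, y, rfl⟩
    exact Submodule.subset_span ⟨_, _, (E.linner_lmul a x y).symm⟩
  · rw [mul_zero]; exact zero_mem _
  · intro b c _ _ h h'
    rw [mul_add]; exact add_mem h h'
  · intro c b _ h
    rw [mul_smul_comm]; exact Submodule.smul_mem _ c h

theorem star_mem_linnerSpan {b : A} (hb : b ∈ E.linnerSpan) : star b ∈ E.linnerSpan := by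
  refine Submodule.span_induction ?_ ?_ ?_ ?_ hb
  · rintro _ ⟨x, y, rfl⟩
    exact Submodule.subset_span ⟨_, _, E.star_linner x y⟩
  · rw [star_zero]; exact zero_mem _
  · intro b c _ _ h h'
    rw [star_add]; exact add_mem h h'
  · intro c b _ h
    rw [star_smul]; exact Submodule.smul_mem _ _ h

/-- `_A I`, the closure of the linear span of the left inner products. -/
def leftIdeal : NonUnitalStarSubalgebra ℂ A where
  carrier := closure (E.linnerSpan : Set A)
  zero_mem' := subset_closure (zero_mem E.linnerSpan)
  add_mem' ha hb := map_mem_closure₂ continuous_add ha hb fun _ h _ h' => add_mem h h'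
  smul_mem' c a ha := by
    have _ := (ProCStarAlgebra.withSeminorms (p := p)).continuousSMul
    exact map_mem_closure (continuous_const_smul c) ha fun _ h => Submodule.smul_mem _ c h
  mul_mem' {a b} _ hb := by
    have hp := ProCStarAlgebra.withSeminorms (p := p)
    have hc : Continuous (LinearMap.mulLeft ℂ a) :=
      WithSeminorms.continuous_of_isBounded hp hp _ fun l => ⟨{l}, (p l a).toNNReal, fun b => by
        rw [Finset.sup_singleton]
        change p l (a * b) ≤ (p l a).toNNReal * p l b
        rw [Real.coe_toNNReal _ (apply_nonneg _ _)]
        exact CStarFamily.mul_le l a b⟩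
    exact map_mem_closure hc hb fun _ h => E.mul_mem_linnerSpan a h
  star_mem' {a} ha := by
    have hp := ProCStarAlgebra.withSeminorms (p := p)
    have hc : Continuous (starLinearEquiv ℂ (A := A) : A →ₗ⋆[ℂ] A) :=
      WithSeminorms.continuous_of_isBounded hp hp _ fun l => ⟨{l}, 1, fun b => by
        rw [Finset.sup_singleton, one_smul]
        exact (seminorm_star p l b).le⟩
    exact map_mem_closure hc ha fun _ h => E.star_mem_linnerSpan h

end HilbertBimodule

end Correspondences

end ProCStar

end

/-! The identity `_A⟨x, y⟩ z = x ⟨y, z⟩_A` says that the left action `φ` sends `_A⟨x, y⟩` to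
`θ_{x,y}`. Hence `φ` maps the span of the left inner products onto the finite rank operators, and
everything reduces to showing that `φ` is isometric on `_A I` for each seminorm.

Let `q_l(a)` be the operator seminorm of `φ(a)` at level `l`. It is a `C⋆`-seminorm with `q_l ≤
p_l`. The decisive fact is `le_of_annihilates`: if `c` annihilates `ker q_l` modulo `ker p_l`, then
`p_l(c) ≤ q_l(c)`. Functional calculus cuts off the part of `c⋆c` above `q_l(c)²`; this part lies in
`ker q_l`, so `c` kills it, and the norm `p_l(c)²` of `c⋆c` cannot exceed `q_l(c)²`.

Elements of `_A I` have this annihilation property because `_A⟨x, y⟩ b = _A⟨x, b⋆y⟩`, where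
Cauchy–Schwarz for the left inner product applies. This requires that the left and right inner
products give the same seminorms on `X` (`leftModule_seminorm`). So `q_l = p_l` on `_A I`
(`leftSeminorm_eq`), and completeness of `A` makes `φ` map `_A I` homeomorphically onto `K_A(X)`.

For `𝒥_X = _A I`, annihilation is part of the definition of `𝒥_X`. If `a ∈ 𝒥_X`, compactness at
level `l` gives `s` in the span with `q_l(a - s) < ε`. Since `a - s` still annihilates, `p_l(a - s)
< ε`, so `a` lies in the closure of the span. -/

noncomputable section

namespace ProCStar

open Filter Topology

universe u

/-! ### Functional calculus and comparison of `C⋆`-seminorms -/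

section FunctionalCalculus

set_option linter.unusedSectionVars false

variable {Λ : Type*} {A : Type u} [NonUnitalRing A] [StarRing A] [Module ℂ A]
  [IsScalarTower ℂ A A] [SMulCommClass ℂ A A] [StarModule ℂ A]

/-- A polynomial without constant term can be evaluated in a non-unital algebra, and
`⋆`-homomorphisms into `C⋆`-algebras respect this. -/
theorem exists_polynomial_eval (h : A) (Q : Polynomial ℝ) (hQ : Q.eval 0 = 0) :
    ∃ b : A, ∀ (C : Type u) (_ : CStarAlgebra C) (ι : A →⋆ₙₐ[ℂ] C),
      ι b = Polynomial.aeval (ι h) Q := by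
  obtain ⟨R, rfl⟩ := Polynomial.X_dvd_iff.2 (Polynomial.coeff_zero_eq_eval_zero Q ▸ hQ)
  refine ⟨(Polynomial.aeval (h : Unitization ℂ A) (Polynomial.X * R)).snd, fun C _ ι => ?_⟩
  set b := Polynomial.aeval (h : Unitization ℂ A) (Polynomial.X * R) with hb
  -- The factor `X` makes the scalar part of the value in the unitization vanish, so the value
  -- already lies in `A`.
  have h1 : (b.snd : Unitization ℂ A) = b := by
    refine Unitization.ext ?_ rfl
    rw [hb, map_mul, Polynomial.aeval_X, Unitization.fst_mul, Unitization.fst_inr]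
    exact (zero_mul _).symm
  have h2 : ∀ a : A, Unitization.starLift ι (a : Unitization ℂ A) = ι a := fun a => by
    change algebraMap ℂ C 0 + ι a = ι a
    rw [map_zero, zero_add]
  rw [← h2, h1, hb, ← h2 h]
  exact (Polynomial.aeval_algHom_apply
    ((Unitization.starLift ι).toAlgHom.restrictScalars ℝ) _ _).symm

/-- A continuous function on `ℝ` that vanishes at `0` is locally uniformly approximated by
polynomials without constant term. -/
theorem exists_polynomial_seq {f : ℝ → ℝ} (hf : Continuous f) (h0 : f 0 = 0) :
    ∃ Q : ℕ → Polynomial ℝ, ∀ n, (Q n).eval 0 = 0 ∧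
      ∀ t ∈ Set.Icc (-n : ℝ) n, |(Q n).eval t - f t| ≤ 1 / ((n : ℝ) + 1) := by
  have key : ∀ n : ℕ, ∃ Q : Polynomial ℝ, Q.eval 0 = 0 ∧
      ∀ t ∈ Set.Icc (-n : ℝ) n, |Q.eval t - f t| ≤ 1 / ((n : ℝ) + 1) := by
    intro n
    -- Half of the tolerance is kept for removing the constant term: since `f 0 = 0`, the size of
    -- `P(0)` is itself at most the approximation error.
    obtain ⟨P, hP⟩ := exists_polynomial_near_of_continuousOn (-n : ℝ) n f hf.continuousOn
      (1 / ((n : ℝ) + 1) / 2) (by positivity)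
    refine ⟨P - Polynomial.C (P.eval 0), by simp, fun t ht => ?_⟩
    have h1 := hP t ht
    have h2 := hP 0 ⟨by simp, by simp⟩
    rw [h0, sub_zero] at h2
    rw [Polynomial.eval_sub, Polynomial.eval_C, sub_right_comm]
    have h3 := abs_sub (P.eval t - f t) (P.eval 0)
    linarith
  exact ⟨fun n => (key n).choose, fun n => (key n).choose_spec⟩

variable [UniformSpace A] [IsUniformAddGroup A]

/-- A filter that is Cauchy for each of the defining seminorms converges. -/
theorem exists_le_nhds (p : Λ → Seminorm ℂ A) [ProCStarAlgebra p] (F : Filter A) [F.NeBot]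
    (hF : ∀ l, ∀ ε > 0, ∃ s ∈ F, ∀ x ∈ s, ∀ y ∈ s, p l (x - y) < ε) : ∃ a, F ≤ 𝓝 a := by
  have _ := ProCStarAlgebra.complete (p := p)
  have hp := ProCStarAlgebra.withSeminorms (p := p)
  refine CompleteSpace.complete ⟨‹_›, ?_⟩
  rw [uniformity_eq_comap_nhds_zero, ← tendsto_iff_comap]
  refine (hp.tendsto_nhds _ 0).2 fun l ε hε => ?_
  obtain ⟨s, hs, h⟩ := hF l ε hε
  filter_upwards [prod_mem_prod hs hs] with x hx
  rw [sub_zero]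
  exact h _ hx.2 _ hx.1

theorem eq_of_forall_seminorm (p : Λ → Seminorm ℂ A) [ProCStarAlgebra p] {a b : A}
    (h : ∀ l, p l (a - b) = 0) : a = b := by
  have _ := ProCStarAlgebra.hausdorff (p := p)
  by_contra hne
  obtain ⟨l, hl⟩ := (ProCStarAlgebra.withSeminorms (p := p)).separating_of_T1 _ (sub_ne_zero.2 hne)
  exact hl (h l)

/-- Continuous functional calculus in a pro-`C⋆`-algebra. -/
theorem exists_cfc (p : Λ → Seminorm ℂ A) [ProCStarAlgebra p] {h : A} (hh : IsSelfAdjoint h)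
    {f : ℝ → ℝ} (hf : Continuous f) (h0 : f 0 = 0) :
    ∃ b : A, ∀ (l : Λ) (C : Type u) (_ : CStarAlgebra C) (ι : A →⋆ₙₐ[ℂ] C),
      (∀ a, ‖ι a‖ ≤ p l a) → ι b = cfc f (ι h) := by
  obtain ⟨Q, hQ⟩ := exists_polynomial_seq hf h0
  choose b hb using fun n => exists_polynomial_eval h (Q n) (hQ n).1
  -- As soon as `n ≥ p l h`, the spectrum of `ι h` lies in `[-n, n]`, where `Q n` is close to `f`.
  -- The bound depends on `ι` only through this threshold, so one sequence `b` serves all levels and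
  -- all contractive representations.
  have key : ∀ (l : Λ) (C : Type u) (_ : CStarAlgebra C) (ι : A →⋆ₙₐ[ℂ] C),
      (∀ a, ‖ι a‖ ≤ p l a) → ∀ n : ℕ, p l h ≤ n →
        ‖ι (b n) - cfc f (ι h)‖ ≤ 1 / ((n : ℝ) + 1) := by
    intro l C _ ι hι n hn
    have hs : IsSelfAdjoint (ι h) := hh.map ι
    rw [hb, ← cfc_polynomial (Q n) (ι h) hs, ← cfc_sub _ _ (ι h)
      (Polynomial.continuous _).continuousOn hf.continuousOn]
    rcases subsingleton_or_nontrivial C with hC | hC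
    · rw [Subsingleton.elim (cfc _ (ι h)) 0, norm_zero]
      positivity
    refine norm_cfc_le (by positivity) fun t ht => (hQ n).2 t ?_
    have h1 := (spectrum.norm_le_norm_of_mem ht).trans ((hι h).trans hn)
    exact abs_le.1 h1
  have hcau : ∀ l, ∀ ε > 0, ∃ s ∈ map b atTop, ∀ x ∈ s, ∀ y ∈ s, p l (x - y) < ε := by
    intro l ε hε
    -- An isometric representation of level `l` turns the estimate into one for `p l` itself.
    obtain ⟨C, _, ι, hι⟩ := exists_rep p l
    have hlim := (tendsto_one_div_add_atTop_nhds_zero_nat (𝕜 := ℝ)).eventually_lt_const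
      (half_pos hε)
    obtain ⟨N, hN⟩ := eventually_atTop.1
      (hlim.and (tendsto_natCast_atTop_atTop.eventually_ge_atTop (p l h)))
    refine ⟨b '' Set.Ici N, image_mem_map (Ici_mem_atTop N), ?_⟩
    rintro _ ⟨m, hm, rfl⟩ _ ⟨n, hn, rfl⟩
    have h1 := key l C _ ι (fun a => (hι a).le) m (hN m hm).2
    have h2 := key l C _ ι (fun a => (hι a).le) n (hN n hn).2
    have h3 := norm_sub_le (ι (b m) - cfc f (ι h)) (ι (b n) - cfc f (ι h))
    rw [sub_sub_sub_cancel_right, ← map_sub, hι] at h3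
    linarith [(hN m hm).1, (hN n hn).1]
  obtain ⟨a, ha⟩ := exists_le_nhds p _ hcau
  refine ⟨a, fun l C _ ι hι => ?_⟩
  have h1 : Tendsto (fun n => ι (b n)) atTop (𝓝 (ι a)) := by
    rw [tendsto_iff_norm_sub_tendsto_zero]
    have h2 := ((ProCStarAlgebra.withSeminorms (p := p)).continuous_seminorm l).tendsto 0
    rw [map_zero] at h2
    have h3 : Tendsto (fun n => b n - a) atTop (𝓝 0) := by
      simpa using (show Tendsto b atTop (𝓝 a) from ha).sub_const a
    refine squeeze_zero (fun _ => norm_nonneg _) (fun n => ?_) (h2.comp h3)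
    rw [← map_sub]
    exact hι _
  have h2 : Tendsto (fun n => ι (b n)) atTop (𝓝 (cfc f (ι h))) := by
    rw [tendsto_iff_norm_sub_tendsto_zero]
    refine squeeze_zero' (Eventually.of_forall fun _ => norm_nonneg _) ?_
      (tendsto_one_div_add_atTop_nhds_zero_nat (𝕜 := ℝ))
    filter_upwards [tendsto_natCast_atTop_atTop.eventually_ge_atTop (p l h)] with n hn
    exact key l C _ ι hι n hn
  exact tendsto_nhds_unique h1 h2

/-- If `q` is a `C⋆`-seminorm below `p l` and `c` annihilates the kernel of `q` modulo the kernel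
of `p l`, then `q` and `p l` agree at `c`. -/
theorem le_of_annihilates (p : Λ → Seminorm ℂ A) [ProCStarAlgebra p] (l : Λ)
    (q : Seminorm ℂ A) [CStarFamily fun _ : Unit => q] (hq : q ≤ p l) {c : A}
    (hc : ∀ b, q b = 0 → p l (c * b) = 0) : p l c ≤ q c := by
  obtain ⟨C, _, ι, hι⟩ := exists_rep p l
  obtain ⟨D, _, ρ, hρ⟩ := exists_rep (fun _ : Unit => q) ()
  have hcs : ∀ b : A, q (star b * b) = q b ^ 2 :=
    CStarFamily.star_mul_self (p := fun _ : Unit => q) ()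
  -- This function vanishes up to `q(c)²` and is positive beyond, so it isolates the part of `c⋆c`
  -- that `q` does not see.
  have hf : Continuous fun t : ℝ => max (t - q c ^ 2) 0 := by fun_prop
  obtain ⟨b, hb⟩ := exists_cfc p (IsSelfAdjoint.star_mul_self c) hf
    (max_eq_right (by nlinarith [sq_nonneg (q c)]))
  have hb1 : q b = 0 := by
    -- The representation `ρ` for `q` is dominated by `p l`, so the same `b` becomes the functional
    -- calculus there. The spectrum of `ρ (c⋆c)` is bounded by `q(c)²`, where the cut-off function
    -- is zero.
    rw [← hρ, hb l D _ ρ fun a => (hρ a).trans_le (hq a), norm_eq_zero]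
    have hs : IsSelfAdjoint (ρ (star c * c)) := (IsSelfAdjoint.star_mul_self c).map ρ
    rcases subsingleton_or_nontrivial D with hD | hD
    · exact Subsingleton.elim _ _
    rw [← cfc_zero ℝ (ρ (star c * c))]
    refine cfc_congr fun t ht => max_eq_right ?_
    have h1 := spectrum.norm_le_norm_of_mem ht
    rw [hρ, hcs] at h1
    exact sub_nonpos.2 ((le_abs_self t).trans h1)
  have hb2 : ι (star c * c) * ι b = 0 := by
    have h1 : ι (c * b) = 0 := norm_eq_zero.1 ((hι _).trans (hc b hb1))
    rw [← map_mul, mul_assoc, map_mul, h1, mul_zero]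
  rcases subsingleton_or_nontrivial C with hC | hC
  · rw [← hι, Subsingleton.elim (ι c) 0, norm_zero]
    exact apply_nonneg q c
  let _ := CStarAlgebra.spectralOrder C
  have _ := CStarAlgebra.spectralOrderedRing C
  have hs : IsSelfAdjoint (ι (star c * c)) := (IsSelfAdjoint.star_mul_self c).map ι
  have hpos : 0 ≤ ι (star c * c) := by
    rw [map_mul, map_star]
    exact star_mul_self_nonneg _
  -- The function `t * max (t - q(c)²) 0` applied to `ι (c⋆c)` gives `0`, hence it vanishes at the
  -- spectral point `‖ι (c⋆c)‖ = p_l(c)²`. This forces `p_l(c)² = 0` or `p_l(c)² ≤ q(c)²`.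
  have hmem := CStarAlgebra.norm_mem_spectrum_of_nonneg hpos
  rw [hb l C _ ι fun a => (hι a).le] at hb2
  nth_rewrite 1 [← cfc_id ℝ (ι (star c * c))] at hb2
  rw [← cfc_mul _ _ _ continuousOn_id hf.continuousOn] at hb2
  have h2 := norm_apply_le_norm_cfc (fun t : ℝ => id t * max (t - q c ^ 2) 0) (ι (star c * c))
    hmem (continuousOn_id.mul hf.continuousOn) hs
  rw [hb2, norm_zero, norm_le_zero_iff, hι, CStarFamily.star_mul_self, mul_eq_zero] at h2
  refine le_of_sq_le_sq ?_ (apply_nonneg q c)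
  rcases h2 with h2 | h2
  · rw [id] at h2
    rw [h2]
    exact sq_nonneg _
  · exact sub_nonpos.1 (max_eq_right_iff.1 h2)

end FunctionalCalculus

/-! ### The opposite algebra, and passage to the levels `X_l` -/

section Bimodules

set_option linter.unusedSectionVars false

variable {Λ : Type*} {A : Type u} [NonUnitalRing A] [StarRing A] [Module ℂ A]
  [IsScalarTower ℂ A A] [SMulCommClass ℂ A A] [StarModule ℂ A]

/-- The family of seminorms of the opposite algebra. -/
def opFamily (p : Λ → Seminorm ℂ A) (l : Λ) : Seminorm ℂ Aᵐᵒᵖ :=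
  (p l).comp (MulOpposite.opLinearEquiv ℂ).symm.toLinearMap

instance (p : Λ → Seminorm ℂ A) [CStarFamily p] : CStarFamily (opFamily p) where
  mul_le l a b := by
    rw [mul_comm]
    exact CStarFamily.mul_le l b.unop a.unop
  star_mul_self l a := by
    -- The product is reversed in `Aᵐᵒᵖ`, so the identity needed is the one for `a a⋆`.
    have h := CStarFamily.star_mul_self (p := p) l (star a.unop)
    rw [star_star, seminorm_star] at h
    exact h

variable {X : Type*} [AddCommGroup X] [Module ℂ X]

namespace InnerModule

variable {p : Λ → Seminorm ℂ A} [CStarFamily p] (E : InnerModule p X)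

theorem ext_seminorm (hp : ∀ a : A, (∀ l, p l a = 0) → a = 0) {x y : X}
    (h : ∀ l, E.seminorm l (x - y) = 0) : x = y := by
  refine sub_eq_zero.1 (E.inner_self_eq_zero _ (hp _ fun l => ?_))
  rw [← E.seminorm_sq, h, zero_pow two_ne_zero]

/-- With `h = ⟨x, x⟩`, the square of the right side is `p(h³)`, and `p(h)⁴ = p(h⁴) ≤ p(h) p(h³)`.
Applied to both inner products of a bimodule, for which `x ⟨x, x⟩` is the same element, it serves to
compare their seminorms. -/
theorem seminorm_pow_three_le (l : Λ) (x : X) :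
    E.seminorm l x ^ 3 ≤ E.seminorm l (E.rmul x (E.inner x x)) := by
  have hsq : ∀ b : A, star b = b → p l (b * b) = p l b ^ 2 := fun b hb => by
    have h := CStarFamily.star_mul_self (p := p) l b
    rwa [hb] at h
  have hs := E.star_inner x x
  have h1 := hsq (E.inner x x * E.inner x x) (by rw [star_mul, hs])
  have h2 := CStarFamily.mul_le (p := p) l (E.inner x x) (E.inner x x * E.inner x x * E.inner x x)
  rw [hsq _ hs, mul_assoc] at h1
  rw [mul_assoc, h1] at h2
  refine le_of_sq_le_sq ?_ (E.seminorm_nonneg l _)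
  rw [E.seminorm_sq, E.inner_rmul, E.rmul_inner, hs, mul_assoc, ← pow_mul, mul_comm 3 2, pow_mul,
    E.seminorm_sq]
  rcases (apply_nonneg (p l) (E.inner x x)).eq_or_lt with h0 | h0
  · rw [← h0]
    simp
  · refine le_of_mul_le_mul_left ?_ h0
    linarith

/-- The topology is an infimum over `l`, so its closure is contained in the closure for each single
seminorm. -/
theorem mem_closure_finiteRank {T : E.L} (hT : T ∈ closure (E.finiteRank : Set E.L)) (l : Λ)
    {ε : ℝ≥0∞} (hε : 0 < ε) : ∃ S ∈ E.finiteRank, E.opNorm l (T - S) < ε := by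
  let _ := E.opDist l
  have h : T ∈ @closure _ (E.opDist l).toUniformSpace.toTopologicalSpace E.finiteRank :=
    closure.mono (iInf_le _ l) hT
  exact EMetric.mem_closure_iff.1 h ε hε

theorem eventually_opNorm_sub_lt (T : E.L) (l : Λ) {ε : ℝ≥0∞} (hε : 0 < ε) :
    ∀ᶠ S in 𝓝 T, E.opNorm l (S - T) < ε := by
  let d := E.opDist l
  have h : 𝓝 T ≤ @nhds _ d.toUniformSpace.toTopologicalSpace T := nhds_mono (iInf_le _ l)
  exact h (Metric.eball_mem_nhds T hε)

variable (l : Λ)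

/-- The quotient map is onto and preserves the seminorm at `l`, so both suprema run over the same
numbers. -/
theorem level_opNorm_localize (T : E.L) :
    (E.level l).opNorm () (E.localize l T) = E.opNorm l T := by
  refine le_antisymm (iSup₂_le fun x hx => ?_) (iSup₂_le fun x hx => ?_)
  · obtain ⟨x, rfl⟩ := (E.nullSpace l).mkQ_surjective x
    exact le_iSup₂ (f := fun (x : X) (_ : E.seminorm l x ≤ 1) =>
      ENNReal.ofReal (E.seminorm l (T.1 x))) x hx
  · exact le_iSup₂ (f := fun (x : X ⧸ E.nullSpace l) (_ : (E.level l).seminorm () x ≤ 1) =>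
      ENNReal.ofReal ((E.level l).seminorm () ((E.localize l T).1 x))) ((E.nullSpace l).mkQ x) hx

theorem localize_theta (y x : X) : E.localize l (E.theta y x) =
    (E.level l).theta ((E.nullSpace l).mkQ y) ((E.nullSpace l).mkQ x) :=
  E.level_ext l fun _ => rfl

theorem localize_eq_zero_iff (T : E.L) :
    E.localize l T = 0 ↔ ∀ x, E.seminorm l (T.1 x) = 0 := by
  constructor
  · intro h x
    have h1 : (E.localize l T).1 ((E.nullSpace l).mkQ x) = 0 := by rw [h]; rfl
    exact (Submodule.Quotient.mk_eq_zero _).1 h1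
  · exact fun h => E.level_ext l fun x => (Submodule.Quotient.mk_eq_zero _).2 (h x)

/-- Vectors of `X_l` lift to `X`, hence so do the operators `θ`. This moves finite rank
approximations at a level back to `X`. -/
theorem exists_localize_eq {S : (E.level l).L} (hS : S ∈ (E.level l).finiteRank) :
    ∃ T ∈ E.finiteRank, E.localize l T = S := by
  refine Submodule.span_induction ?_ ?_ ?_ ?_ hS
  · rintro _ ⟨y, x, rfl⟩
    obtain ⟨y, rfl⟩ := (E.nullSpace l).mkQ_surjective y
    obtain ⟨x, rfl⟩ := (E.nullSpace l).mkQ_surjective x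
    exact ⟨_, Submodule.subset_span ⟨y, x, rfl⟩, E.localize_theta l y x⟩
  · exact ⟨0, zero_mem _, map_zero _⟩
  · rintro _ _ _ _ ⟨T, hT, rfl⟩ ⟨T', hT', rfl⟩
    exact ⟨T + T', add_mem hT hT', map_add _ _ _⟩
  · rintro c _ _ ⟨T, hT, rfl⟩
    exact ⟨c • T, Submodule.smul_mem _ c hT, map_smul _ c T⟩

theorem localize_mem_finiteRank {T : E.L} (hT : T ∈ E.finiteRank) :
    E.localize l T ∈ (E.level l).finiteRank := by
  refine Submodule.span_induction ?_ ?_ ?_ ?_ hT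
  · rintro _ ⟨y, x, rfl⟩
    exact Submodule.subset_span ⟨_, _, E.localize_theta l y x⟩
  · rw [map_zero]; exact zero_mem _
  · intro T S _ _ h h'
    rw [map_add]; exact add_mem h h'
  · intro c T _ h
    rw [map_smul]; exact Submodule.smul_mem _ c h

theorem continuous_localize : Continuous (E.localize l) := by
  refine continuous_iInf_rng.2 fun u => continuous_iInf_dom (i := l) ?_
  refine @LipschitzWith.continuous _ _ (E.opDist l) ((E.level l).opDist u) 1 _ fun T S => ?_
  rw [ENNReal.coe_one, one_mul]
  change (E.level l).opNorm () (E.localize l T - E.localize l S) ≤ E.opNorm l (T - S)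
  exact ((congrArg _ (map_sub (E.localize l) T S)).symm.trans (E.level_opNorm_localize l _)).le

end InnerModule

variable [UniformSpace A] [IsUniformAddGroup A]

/-- By directedness the finitely many seminorms of a basic neighbourhood are dominated by one, so
approximation in one seminorm at a time suffices. -/
theorem mem_closure_of_seminorm (p : Λ → Seminorm ℂ A) [ProCStarAlgebra p] {s : Set A}
    (hs : s.Nonempty) {a : A} (h : ∀ l, ∀ ε > 0, ∃ b ∈ s, p l (a - b) < ε) : a ∈ closure s := by
  rcases isEmpty_or_nonempty Λ with hΛ | hΛ
  -- Without seminorms, the Hausdorff condition makes `A` a single point.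
  · obtain ⟨b, hb⟩ := hs
    rw [eq_of_forall_seminorm p (a := a) (b := b) fun l => isEmptyElim l]
    exact subset_closure hb
  · refine mem_closure_iff_nhds.2 fun U hU => ?_
    obtain ⟨t, r, hr, hU⟩ := ((ProCStarAlgebra.withSeminorms (p := p)).mem_nhds_iff a U).1 hU
    obtain ⟨l, hl⟩ := (ProCStarAlgebra.directed (p := p)).finset_le t
    obtain ⟨b, hb, hlt⟩ := h l r hr
    refine ⟨b, hU ?_, hb⟩
    rw [Seminorm.mem_ball]
    exact (Finset.sup_le hl (b - a)).trans_lt (by rwa [map_sub_rev])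

/-! ### The left inner product and its seminorms -/

namespace HilbertBimodule

variable {p : Λ → Seminorm ℂ A} [ProCStarAlgebra p] (E : HilbertBimodule p X)

/-- The left inner product module as a right one over the opposite algebra. -/
def leftModule : InnerModule (opFamily p) X where
  rmul := LinearMap.mk₂ ℂ (fun x a => E.lmul a.unop x) (fun _ _ _ => map_add _ _ _)
    (fun _ _ _ => map_smul _ _ _) (fun _ _ _ => by simp) (fun _ _ _ => by simp)
  rmul_mul x a b := E.mul_lmul b.unop a.unop x
  inner := LinearMap.mk₂'ₛₗ (starRingEnd ℂ) (RingHom.id ℂ)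
    -- The arguments are swapped so that the form is conjugate linear in the first variable.
    (fun x y => MulOpposite.op (E.linner y x)) (fun _ _ _ => by simp) (fun _ _ _ => by simp)
    (fun _ _ _ => by simp) (fun _ _ _ => by simp)
  inner_rmul x y a := congrArg MulOpposite.op (E.linner_lmul a.unop y x)
  star_inner x y := congrArg MulOpposite.op (E.star_linner y x)
  inner_self_nonneg x := by
    obtain ⟨b, hb⟩ := E.linner_self_nonneg x
    -- The reversed product turns `b⋆b` into a positive element of the opposite algebra with root
    -- `op (star b)`.
    refine ⟨MulOpposite.op (star b), congrArg MulOpposite.op (hb.trans ?_)⟩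
    change star b * b = star b * star (star b)
    rw [star_star]
  inner_self_eq_zero x hx := E.linner_self_eq_zero x (MulOpposite.op_injective hx)

/-- The seminorms of `X` for both inner products agree. -/
theorem leftModule_seminorm (l : Λ) (x : X) :
    E.leftModule.seminorm l x = E.seminorm l x := by
  have h1 := E.seminorm_pow_three_le l x
  have h2 := E.leftModule.seminorm_pow_three_le l x
  have h3 := E.seminorm_lmul_le l (E.linner x x) x
  have h4 : E.leftModule.seminorm l (E.rmul x (E.inner x x)) ≤
      p l (E.inner x x) * E.leftModule.seminorm l x := E.lseminorm_rmul_le l (E.inner x x) x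
  have h5 : E.leftModule.rmul x (E.leftModule.inner x x) = E.rmul x (E.inner x x) :=
    E.linner_lmul_eq x x x
  have h6 : E.leftModule.seminorm l x ^ 2 = p l (E.linner x x) := E.leftModule.seminorm_sq l x
  rw [E.linner_lmul_eq, ← h6] at h3
  rw [← E.seminorm_sq] at h4
  rw [h5] at h2
  -- With `s`, `t` the two seminorms of `x`, contractivity of the left action gives `s³ ≤ ‖_A⟨x, x⟩
  -- x‖ ≤ t² s`; the right action gives the same with the roles exchanged.
  have key : ∀ s t : ℝ, 0 ≤ s → 0 ≤ t → s ^ 3 ≤ t ^ 2 * s → s ≤ t := by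
    intro s t hs ht h
    rcases hs.eq_or_lt with h0 | h0
    · rwa [← h0]
    · refine le_of_sq_le_sq (le_of_mul_le_mul_right ?_ h0) ht
      rwa [← pow_succ]
  exact le_antisymm
    (key _ _ (E.leftModule.seminorm_nonneg l x) (E.seminorm_nonneg l x) (h2.trans h4))
    (key _ _ (E.seminorm_nonneg l x) (E.leftModule.seminorm_nonneg l x) (h1.trans h3))

/-- Cauchy–Schwarz for the left inner product. -/
theorem seminorm_linner_le (l : Λ) (x y : X) :
    p l (E.linner x y) ≤ E.seminorm l x * E.seminorm l y := by
  rw [← E.leftModule_seminorm, ← E.leftModule_seminorm, mul_comm]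
  exact E.leftModule.cauchy_schwarz l y x

/-! ### The left action as a `C⋆`-seminorm on `A` -/

theorem opNorm_leftOp_le (l : Λ) (a : A) :
    E.opNorm l (E.leftOp a) ≤ ENNReal.ofReal (p l a) :=
  E.opNorm_le l _ (p l a).toNNReal fun x => by
    rw [Real.coe_toNNReal _ (apply_nonneg _ _)]
    exact E.seminorm_lmul_le l a x

theorem leftOp_add (a b : A) : E.leftOp (a + b) = E.leftOp a + E.leftOp b :=
  map_add E.toCorrespondence.φ a b

theorem leftOp_sub (a b : A) : E.leftOp (a - b) = E.leftOp a - E.leftOp b :=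
  map_sub E.toCorrespondence.φ a b

theorem leftOp_linner (x y : X) : E.leftOp (E.linner x y) = E.theta x y :=
  Subtype.ext (LinearMap.ext (E.linner_lmul_eq x y))

/-- The real valued operator seminorm `a ↦ p_l(φ(a))` on `A`. -/
def leftSeminorm (l : Λ) : Seminorm ℂ A :=
  Seminorm.ofSMulLE (fun a => (E.opNorm l (E.leftOp a)).toReal)
    (by
      change (E.opNorm l (E.toCorrespondence.φ 0)).toReal = 0
      rw [map_zero]
      exact congrArg ENNReal.toReal (E.opNorm_zero l))
    (fun a b => by
      have h : ∀ a, E.opNorm l (E.leftOp a) ≠ ⊤ := fun a =>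
        ne_top_of_le_ne_top ENNReal.ofReal_ne_top (E.opNorm_leftOp_le l a)
      rw [← ENNReal.toReal_add (h a) (h b), E.leftOp_add]
      exact ENNReal.toReal_mono (ENNReal.add_ne_top.2 ⟨h a, h b⟩) (E.opNorm_add_le l _ _))
    (fun c a => by
      have h : E.opNorm l (E.leftOp a) ≠ ⊤ :=
        ne_top_of_le_ne_top ENNReal.ofReal_ne_top (E.opNorm_leftOp_le l a)
      have h1 := ENNReal.toReal_mono (ENNReal.mul_ne_top ENNReal.coe_ne_top h)
        (E.opNorm_smul_le l c (E.leftOp a))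
      rw [ENNReal.toReal_mul, ENNReal.coe_toReal, coe_nnnorm] at h1
      exact (congrArg (fun T => (E.opNorm l T).toReal)
        (map_smul E.toCorrespondence.φ c a)).trans_le h1)

theorem opNorm_leftOp (l : Λ) (a : A) :
    E.opNorm l (E.leftOp a) = ENNReal.ofReal (E.leftSeminorm l a) :=
  (ENNReal.ofReal_toReal (ne_top_of_le_ne_top ENNReal.ofReal_ne_top
    (E.opNorm_leftOp_le l a))).symm

theorem leftSeminorm_le_of_bound (l : Λ) (a : A) {C : ℝ} (hC : 0 ≤ C)
    (h : ∀ x, E.seminorm l (E.lmul a x) ≤ C * E.seminorm l x) : E.leftSeminorm l a ≤ C := by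
  have h1 := E.opNorm_le l (E.leftOp a) ⟨C, hC⟩ h
  exact ENNReal.toReal_le_of_le_ofReal hC (h1.trans_eq (ENNReal.ofReal_eq_coe_nnreal hC).symm)

theorem seminorm_lmul_le_leftSeminorm (l : Λ) (a : A) (x : X) :
    E.seminorm l (E.lmul a x) ≤ E.leftSeminorm l a * E.seminorm l x :=
  E.le_of_opNorm l (E.leftOp a) ⟨E.leftSeminorm l a, apply_nonneg _ _⟩
    ((E.opNorm_leftOp l a).trans (ENNReal.ofReal_eq_coe_nnreal _)).le x

theorem leftSeminorm_le (l : Λ) : E.leftSeminorm l ≤ p l := fun a =>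
  E.leftSeminorm_le_of_bound l a (apply_nonneg _ _) (E.seminorm_lmul_le l a)

/-- The `C⋆`-identity is proved as for operators on a Hilbert space: `⟨ax, ax⟩ = ⟨x, a⋆a x⟩`, and
Cauchy–Schwarz bounds the right side by the operator seminorm of `a⋆a`. -/
instance (l : Λ) : CStarFamily fun _ : Unit => E.leftSeminorm l where
  mul_le _ a b := by
    refine E.leftSeminorm_le_of_bound l _
      (mul_nonneg (apply_nonneg _ _) (apply_nonneg _ _)) fun x => ?_
    rw [E.mul_lmul, mul_assoc]
    exact (E.seminorm_lmul_le_leftSeminorm l a _).trans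
      (mul_le_mul_of_nonneg_left (E.seminorm_lmul_le_leftSeminorm l b x) (apply_nonneg _ _))
  star_mul_self _ a := by
    have hstar : E.leftSeminorm l (star a) = E.leftSeminorm l a :=
      congrArg ENNReal.toReal ((congrArg (E.opNorm l) (map_star E.toCorrespondence.φ a)).trans
        (E.opNorm_star l (E.leftOp a)))
    refine le_antisymm ?_ ?_
    · refine E.leftSeminorm_le_of_bound l _ (sq_nonneg _) fun x => ?_
      have h1 := E.seminorm_lmul_le_leftSeminorm l (star a) (E.lmul a x)
      have h2 := mul_le_mul_of_nonneg_left (E.seminorm_lmul_le_leftSeminorm l a x)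
        (apply_nonneg (E.leftSeminorm l) a)
      rw [hstar] at h1
      rw [E.mul_lmul, sq, mul_assoc]
      exact h1.trans h2
    · rw [← Real.le_sqrt (apply_nonneg _ _) (apply_nonneg _ _)]
      refine E.leftSeminorm_le_of_bound l _ (Real.sqrt_nonneg _) fun x => ?_
      refine le_of_sq_le_sq ?_ (mul_nonneg (Real.sqrt_nonneg _) (E.seminorm_nonneg _ _))
      rw [mul_pow, Real.sq_sqrt (apply_nonneg _ _), E.seminorm_sq, E.inner_lmul, ← E.mul_lmul]
      have h1 := E.cauchy_schwarz l x (E.lmul (star a * a) x)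
      have h2 := mul_le_mul_of_nonneg_left (E.seminorm_lmul_le_leftSeminorm l (star a * a) x)
        (E.seminorm_nonneg l x)
      linarith

theorem leftSeminorm_eq_zero_iff (l : Λ) (b : A) :
    E.leftSeminorm l b = 0 ↔ E.localize l (E.leftOp b) = 0 := by
  rw [E.localize_eq_zero_iff]
  constructor
  · intro h x
    have h1 := E.seminorm_lmul_le_leftSeminorm l b x
    rw [h, zero_mul] at h1
    exact le_antisymm h1 (E.seminorm_nonneg _ _)
  · refine fun h => le_antisymm (E.leftSeminorm_le_of_bound l b le_rfl fun x => ?_)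
      (apply_nonneg _ _)
    rw [zero_mul]
    exact (h x).le

/-- The left ideal annihilates the kernel of the left action, at each level. -/
theorem seminorm_mul_eq_zero {a : A} (ha : a ∈ E.leftIdeal) (l : Λ) {b : A}
    (hb : E.leftSeminorm l b = 0) : p l (a * b) = 0 := by
  have hp := ProCStarAlgebra.withSeminorms (p := p)
  have hb' : E.leftSeminorm l (star b) = 0 := by
    rw [← hb]
    exact seminorm_star (fun _ : Unit => E.leftSeminorm l) () b
  have hspan : ∀ s ∈ E.linnerSpan, p l (s * b) = 0 := by
    intro s hs
    refine Submodule.span_induction ?_ ?_ ?_ ?_ hs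
    · rintro _ ⟨x, y, rfl⟩
      -- Here `_A⟨x, y⟩ b = _A⟨x, b⋆y⟩`, and `b⋆y` has seminorm zero.
      have h1 := E.seminorm_linner_le l x (E.lmul (star b) y)
      have h2 := E.seminorm_lmul_le_leftSeminorm l (star b) y
      rw [hb', zero_mul] at h2
      rw [E.lmul_linner, star_star, le_antisymm h2 (E.seminorm_nonneg _ _), mul_zero] at h1
      exact le_antisymm h1 (apply_nonneg _ _)
    · rw [zero_mul, map_zero]
    · intro s t _ _ h h'
      have h1 := map_add_le_add (p l) (s * b) (t * b)
      rw [h, h', add_zero, ← add_mul] at h1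
      exact le_antisymm h1 (apply_nonneg _ _)
    · intro c s _ h
      rw [smul_mul_assoc, map_smul_eq_mul, h, mul_zero]
  have hc : Continuous (LinearMap.mulRight ℂ b) :=
    WithSeminorms.continuous_of_isBounded hp hp _ fun l => ⟨{l}, (p l b).toNNReal, fun a => by
      rw [Finset.sup_singleton]
      change p l (a * b) ≤ (p l b).toNNReal * p l a
      rw [Real.coe_toNNReal _ (apply_nonneg _ _), mul_comm]
      exact CStarFamily.mul_le l a b⟩
  have hclosed : IsClosed {a : A | p l (a * b) = 0} :=
    isClosed_eq ((hp.continuous_seminorm l).comp hc) continuous_const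
  exact closure_minimal hspan hclosed ha

/-- The left action is isometric on the left ideal at every level. Injectivity, closed range and
continuity of the inverse all rest on this. -/
theorem leftSeminorm_eq {a : A} (ha : a ∈ E.leftIdeal) (l : Λ) :
    E.leftSeminorm l a = p l a :=
  le_antisymm (E.leftSeminorm_le l a) (le_of_annihilates p l (E.leftSeminorm l)
    (E.leftSeminorm_le l) fun _ hb => E.seminorm_mul_eq_zero ha l hb)

/-! ### The left ideal acts by exactly the compact operators -/

theorem leftOp_mem_finiteRank {s : A} (hs : s ∈ E.linnerSpan) : E.leftOp s ∈ E.finiteRank := by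
  change E.toCorrespondence.φ s ∈ E.finiteRank
  refine Submodule.span_induction ?_ ?_ ?_ ?_ hs
  · rintro _ ⟨x, y, rfl⟩
    exact Submodule.subset_span ⟨_, _, E.leftOp_linner x y⟩
  · rw [map_zero]; exact zero_mem _
  · intro a b _ _ h h'
    rw [map_add]; exact add_mem h h'
  · intro c a _ h
    rw [map_smul]; exact Submodule.smul_mem _ c h

theorem exists_leftOp_eq {T : E.L} (hT : T ∈ E.finiteRank) :
    ∃ s ∈ E.linnerSpan, E.leftOp s = T := by
  refine Submodule.span_induction ?_ ?_ ?_ ?_ hT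
  · rintro _ ⟨x, y, rfl⟩
    exact ⟨_, Submodule.subset_span ⟨_, _, rfl⟩, E.leftOp_linner x y⟩
  · exact ⟨0, zero_mem _, map_zero E.toCorrespondence.φ⟩
  · rintro _ _ _ _ ⟨a, ha, rfl⟩ ⟨b, hb, rfl⟩
    exact ⟨a + b, add_mem ha hb, E.leftOp_add a b⟩
  · rintro c _ _ ⟨a, ha, rfl⟩
    exact ⟨c • a, Submodule.smul_mem _ c ha, map_smul E.toCorrespondence.φ c a⟩

theorem continuous_leftOp : Continuous E.leftOp := E.toCorrespondence.continuous_φ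

theorem leftOp_mem_compacts {a : A} (ha : a ∈ E.leftIdeal) : E.leftOp a ∈ E.compacts :=
  map_mem_closure E.continuous_leftOp ha fun _ h => E.leftOp_mem_finiteRank h

/-- Closed range of an isometry on a complete space: elements of the span whose operators approach
`T` are Cauchy in `A`, and their limit acts as `T`. Filters replace sequences because there may be
uncountably many seminorms. -/
theorem exists_mem_leftIdeal {T : E.L} (hT : T ∈ E.compacts) :
    ∃ a ∈ E.leftIdeal, E.leftOp a = T := by
  have hT' : T ∈ closure (E.leftOp '' E.linnerSpan) := closure_mono
    (fun S hS => E.exists_leftOp_eq hS) hT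
  -- Elements of the span whose operators are close to `T`; the filter is proper because `T` is a
  -- limit of such operators.
  let F : Filter A := comap E.leftOp (𝓝 T) ⊓ 𝓟 E.linnerSpan
  have hmem : (E.linnerSpan : Set A) ∈ F := mem_inf_of_right (mem_principal_self _)
  have hF : F.NeBot := by
    refine inf_principal_neBot_iff.2 fun U hU => ?_
    obtain ⟨V, hV, hVU⟩ := mem_comap.1 hU
    obtain ⟨_, hS, s, hs, rfl⟩ := mem_closure_iff_nhds.1 hT' V hV
    exact ⟨s, hVU hS, hs⟩
  have hnear : ∀ l, ∀ ε > 0, ∀ᶠ a in F, E.opNorm l (E.leftOp a - T) < ε := fun l ε hε =>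
    mem_inf_of_left (preimage_mem_comap (E.eventually_opNorm_sub_lt T l hε))
  obtain ⟨a, ha⟩ := exists_le_nhds p F fun l ε hε => by
    refine ⟨_, inter_mem hmem (hnear l (ENNReal.ofReal (ε / 2)) (by simpa using hε)), ?_⟩
    rintro x ⟨hx, hx'⟩ y ⟨hy, hy'⟩
    -- The difference stays in the ideal, so its seminorm in `A` equals its operator seminorm, which
    -- is below `ε/2 + ε/2`.
    have hxy : x - y ∈ E.leftIdeal := subset_closure (sub_mem hx hy)
    have h1 := E.opNorm_add_le l (E.leftOp x - T) (-(E.leftOp y - T))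
    rw [E.opNorm_neg, ← sub_eq_add_neg, sub_sub_sub_cancel_right, ← E.leftOp_sub,
      E.opNorm_leftOp, E.leftSeminorm_eq hxy] at h1
    have h2 := h1.trans_lt (ENNReal.add_lt_add hx' hy')
    rw [← ENNReal.ofReal_add (by positivity) (by positivity), add_halves] at h2
    exact (ENNReal.ofReal_lt_ofReal_iff hε).1 h2
  refine ⟨a, mem_closure_iff_clusterPt.2 (hF.mono (le_inf ha (le_principal_iff.2 hmem))), ?_⟩
  have hzero : ∀ l, E.opNorm l (E.leftOp a - T) = 0 := by
    intro l
    refine le_antisymm (le_of_forall_gt fun ε hε => ?_) zero_le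
    have hε2 : 0 < ε / 2 := ENNReal.half_pos hε.ne'
    have h1 : ∀ᶠ b in F, E.opNorm l (E.leftOp b - E.leftOp a) < ε / 2 :=
      (E.continuous_leftOp.continuousAt.mono_left ha).eventually
        (E.eventually_opNorm_sub_lt _ l hε2)
    obtain ⟨b, hb, hb'⟩ := (h1.and (hnear l _ hε2)).exists
    have h2 := E.opNorm_add_le l (-(E.leftOp b - E.leftOp a)) (E.leftOp b - T)
    rw [E.opNorm_neg, neg_sub, sub_add_sub_cancel] at h2
    exact h2.trans_lt ((ENNReal.add_lt_add hb hb').trans_eq (ENNReal.add_halves ε))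
  refine Subtype.ext (LinearMap.ext fun x => E.ext_seminorm (fun b hb => ?_) fun l => ?_)
  · exact eq_of_forall_seminorm p fun l => by rw [sub_zero, hb l]
  · have h1 := E.le_of_opNorm l (E.leftOp a - T) 0 (hzero l).le x
    rw [NNReal.coe_zero, zero_mul] at h1
    exact le_antisymm h1 (E.seminorm_nonneg _ _)

/-! ### The ideal `𝒥_X` equals the left ideal -/

theorem mem_leftIdeal_of_mem_J {a : A} (ha : a ∈ E.toCorrespondence.J) : a ∈ E.leftIdeal := by
  have ha' : ∀ l, a ∈ E.toCorrespondence.JLevel l := NonUnitalStarAlgebra.mem_iInf.1 ha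
  refine mem_closure_of_seminorm p ⟨0, zero_mem E.linnerSpan⟩ fun l ε hε => ?_
  obtain ⟨S, hS, hlt⟩ := (E.level l).mem_closure_finiteRank (ha' l).1 ()
    (ENNReal.ofReal_pos.2 hε)
  obtain ⟨T, hT, rfl⟩ := E.exists_localize_eq l hS
  obtain ⟨s, hs, rfl⟩ := E.exists_leftOp_eq hT
  refine ⟨s, hs, ?_⟩
  -- Both `a ∈ 𝒥_X` and `s ∈ _A I` annihilate the kernel of the action at level `l`, hence so does
  -- `a - s`. The operator approximation therefore becomes an approximation in `A`.
  have h1 : p l (a - s) ≤ E.leftSeminorm l (a - s) :=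
    le_of_annihilates p l _ (E.leftSeminorm_le l) fun b hb => by
      have h2 := Level.mk_eq_zero.1 ((ha' l).2 b ((E.leftSeminorm_eq_zero_iff l b).1 hb))
      have h3 := E.seminorm_mul_eq_zero (subset_closure hs) l hb
      have h4 := map_sub_le_add (p l) (a * b) (s * b)
      rw [h2, h3, add_zero, ← sub_mul] at h4
      exact le_antisymm h4 (apply_nonneg _ _)
  refine h1.trans_lt ((ENNReal.ofReal_lt_ofReal_iff hε).1 ?_)
  rw [← E.opNorm_leftOp, E.leftOp_sub, ← E.level_opNorm_localize, map_sub]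
  exact hlt

/-- The continuous map `π_l` carries finite rank operators to finite rank ones, hence compacts to
compacts; the annihilation condition is `seminorm_mul_eq_zero`. -/
theorem mem_J_of_mem_leftIdeal {a : A} (ha : a ∈ E.leftIdeal) : a ∈ E.toCorrespondence.J := by
  refine NonUnitalStarAlgebra.mem_iInf.2 fun l => ⟨?_, fun b hb => ?_⟩
  · exact map_mem_closure (E.continuous_localize l) (E.leftOp_mem_compacts ha)
      fun _ h => E.localize_mem_finiteRank l h
  · exact Level.mk_eq_zero.2
      (E.seminorm_mul_eq_zero ha l ((E.leftSeminorm_eq_zero_iff l b).2 hb))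

theorem J_eq_leftIdeal : E.toCorrespondence.J = E.leftIdeal :=
  le_antisymm (fun _ => E.mem_leftIdeal_of_mem_J) fun _ => E.mem_J_of_mem_leftIdeal

/-! ### The pro-`C⋆`-isomorphism -/

/-- The left action as a `⋆`-homomorphism from the left ideal to the compact operators. -/
def leftIdealHom : E.leftIdeal →⋆ₙₐ[ℂ] E.compacts where
  toFun a := ⟨E.leftOp a, E.leftOp_mem_compacts a.2⟩
  map_smul' c a := Subtype.ext (map_smul E.toCorrespondence.φ c (a : A))
  map_zero' := Subtype.ext (map_zero E.toCorrespondence.φ)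
  map_add' a b := Subtype.ext (map_add E.toCorrespondence.φ (a : A) b)
  map_mul' a b := Subtype.ext (map_mul E.toCorrespondence.φ (a : A) b)
  map_star' a := Subtype.ext (map_star E.toCorrespondence.φ (a : A))

theorem leftIdealHom_bijective : Function.Bijective E.leftIdealHom := by
  refine ⟨fun a b hab => Subtype.ext (eq_of_forall_seminorm p fun l => ?_), fun T => ?_⟩
  · have h1 : E.leftOp a = E.leftOp b := congrArg Subtype.val hab
    rw [← E.leftSeminorm_eq (sub_mem a.2 b.2), E.leftSeminorm_eq_zero_iff, E.leftOp_sub, h1,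
      sub_self, map_zero]
  · obtain ⟨a, ha, h⟩ := E.exists_mem_leftIdeal T.2
    exact ⟨⟨a, ha⟩, Subtype.ext h⟩

/-- The isomorphism of the left ideal with the compact operators. -/
def leftIdealEquiv : E.leftIdeal ≃⋆ₐ[ℂ] E.compacts :=
  StarAlgEquiv.ofBijective E.leftIdealHom E.leftIdealHom_bijective

theorem continuous_leftIdealEquiv : Continuous E.leftIdealEquiv :=
  Continuous.subtype_mk (E.continuous_leftOp.comp continuous_subtype_val) _

theorem continuous_leftIdealEquiv_symm : Continuous E.leftIdealEquiv.symm := by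
  refine continuous_induced_rng.2 (continuous_iff_continuousAt.2 fun T => ?_)
  refine ((ProCStarAlgebra.withSeminorms (p := p)).tendsto_nhds _ _).2 fun l ε hε => ?_
  filter_upwards [continuous_subtype_val.continuousAt.eventually
    (E.eventually_opNorm_sub_lt (T : E.L) l (ENNReal.ofReal_pos.2 hε))] with S hS
  obtain ⟨a, rfl⟩ := E.leftIdealEquiv.surjective T
  obtain ⟨b, rfl⟩ := E.leftIdealEquiv.surjective S
  have hS' : E.opNorm l (E.leftOp b - E.leftOp a) < ENNReal.ofReal ε := hS
  -- The isometry at level `l` turns closeness of the operators into closeness of `b` and `a` with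
  -- the same `ε`.
  rw [← E.leftOp_sub, E.opNorm_leftOp, E.leftSeminorm_eq (sub_mem b.2 a.2)] at hS'
  have hb : E.leftIdealEquiv.symm (E.leftIdealEquiv b) = b := E.leftIdealEquiv.symm_apply_apply b
  have ha : E.leftIdealEquiv.symm (E.leftIdealEquiv a) = a := E.leftIdealEquiv.symm_apply_apply a
  change p l ((E.leftIdealEquiv.symm (E.leftIdealEquiv b) : A) -
    (E.leftIdealEquiv.symm (E.leftIdealEquiv a) : A)) < ε
  rw [hb, ha]
  exact (ENNReal.ofReal_lt_ofReal_iff hε).1 hS'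

end HilbertBimodule

end Bimodules

end ProCStar

end

theorem corollary6p5 {Λ A X : Type*}
    [NonUnitalRing A] [StarRing A] [Module ℂ A] [IsScalarTower ℂ A A] [SMulCommClass ℂ A A]
    [StarModule ℂ A] [UniformSpace A] [IsUniformAddGroup A]
    [AddCommGroup X] [Module ℂ X]
    (p : Λ → Seminorm ℂ A) [ProCStar.ProCStarAlgebra p] (E : ProCStar.HilbertBimodule p X) :
    (∃ Φ : E.leftIdeal ≃⋆ₐ[ℂ] E.compacts, Continuous Φ ∧ Continuous Φ.symm) ∧
    E.toCorrespondence.J = E.leftIdeal ∧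
    ∃ Ψ : E.toCorrespondence.J ≃⋆ₐ[ℂ] E.compacts, Continuous Ψ ∧ Continuous Ψ.symm ∧
      ∀ (a : E.toCorrespondence.J) (x : X), (Ψ a : E.L).1 x = E.lmul (a : A) x := by
  refine ⟨⟨E.leftIdealEquiv, E.continuous_leftIdealEquiv, E.continuous_leftIdealEquiv_symm⟩,
    E.J_eq_leftIdeal, ?_⟩
  -- Once the two ideals are identified, `Ψ` is the isomorphism of the first claim, which is the
  -- left action by construction.
  rw [E.J_eq_leftIdeal]
  exact ⟨E.leftIdealEquiv, E.continuous_leftIdealEquiv, E.continuous_leftIdealEquiv_symm,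
    fun _ _ => rfl⟩
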